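/- **Setting.** Let $G$ be a group and $S\subseteq G$ a subsemigroup with $G=S^{-1}S$ (so $S$ is an Ore semigroup with enveloping group $G$). Let $\psi$ be an action of $G$ by automorphisms of a group $N$, and let $M$ be a normal subgroup of $N$ such that $M\subseteq\psi_s(M)$ and $|M/\psi_s^{-1}(M)|<\infty$ for all $s\in S$, and $\bigcap_{s\in S}\psi_s^{-1}(M)=\{e\}$. For a locally compact group $X$ with Haar measure $\mu$, let $C^*(X)$ be its full group $C^*$-algebra, generated by the elements $f=\int_X f(x)\delta_x\,d\mu(x)$, $f\in C_c(X)$, where $\delta$ is the universal strongly continuous unitary representation of $X$; for discrete $X$ (with counting measure) the $\delta_x$ themselves belong to $C^*(X)$. The group $N/M$ is discrete. Direct $S$ by $s\le t\iff t\in Ss\cup\{s\}$, and let $N_\infty=\varprojlim_{s\in S} N/\psi_s^{-1}(M)$, realised as the group of compatible families in $\prod_{s\in S} N/\psi_s^{-1}(M)$, with the totally disconnected locally compact group topology in which the normal subgroup $K=\varprojlim_{s\in S} M/\psi_s^{-1}(M)$, with its profinite topology, is compact and open. Let $\mu$ be the Haar measure on $N_\infty$ with $\mu(K)=1$, let $j:N\to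 N_\infty$ be the canonical homomorphism $j(n)=(n\psi_s^{-1}(M))_{s\in S}$, and let $\theta$ be the action of $G$ by continuous automorphisms of $N_\infty$ determined by $(\theta_t(x))_s=\psi_t(x_{st})$ for $s,t\in S$, where $\psi_t$ also denotes the induced isomorphism $N/\psi_{st}^{-1}(M)\to N/\psi_s^{-1}(M)$. **Theorem.** There are * a unique action $\alpha$ of $S$ by $*$-endomorphisms of $C^*(N/M)$ such that for all $s\in S$, $n\in N$ $$\alpha_s(\delta_{nM})=\frac1{|M:\psi_s^{-1}(M)|}\sum_{\{mM\in N/M\,:\,\psi_s^{-1}(m)M=nM\}}\delta_{mM};$$ * a unique action $\theta_*$ of $G$ by $*$-automorphisms of $C^*(N_\infty)$ such that $(\theta_*)_g\bigl(\int f(x)\delta_x\,d\mu(x)\bigr)=\int f(x)\delta_{\theta_g(x)}\,d\mu(x)$ for all $g\in G$, $f\in C_c(N_\infty)$; * a unique $*$-homomorphism $i:C^*(N/M)\to C^*(N_\infty)$ such that $i(\delta_{nM})=\chi_{j(n)K}$ for all $n\in N$. Moreover, $(C^*(N_\infty),G,\theta_*)$ is, with the embedding $i$, a minimal automorphic dilation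 of $(C^*(N/M),S,\alpha)$: the homomorphism $i$ is injective, $i\circ\alpha_s=(\theta_*)_s\circ i$ for all $s\in S$, and $\bigcup_{s\in S}(\theta_*)_s^{-1}\bigl(i(C^*(N/M))\bigr)$ is dense in $C^*(N_\infty)$. -/

import Mathlib

open MeasureTheory
open scoped CompactlySupported ENNReal

universe u v w

noncomputable section

/-! ### Group C*-algebras -/

/-- A strongly continuous unitary representation of a topological group `X` on a complex Hilbert
space (living in the universe `w`). -/
structure UnitaryRep (X : Type u) [Group X] [TopologicalSpace X] where
  /-- the Hilbert space -/
  H : Type w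
  [normedAddCommGroup : NormedAddCommGroup H]
  [innerProductSpace : InnerProductSpace ℂ H]
  [completeSpace : CompleteSpace H]
  /-- the unitary operators -/
  U : X →* unitary (H →L[ℂ] H)
  continuous_U : ∀ h : H, Continuous fun x => (U x : H →L[ℂ] H) h

attribute [instance] UnitaryRep.normedAddCommGroup UnitaryRep.innerProductSpace
  UnitaryRep.completeSpace

section integrals

variable {Y : Type v} [TopologicalSpace Y] [MeasurableSpace Y] [OpensMeasurableSpace Y]
  (μ : Measure Y) [IsFiniteMeasureOnCompacts μ]
  {X : Type u} [Group X] [TopologicalSpace X]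

theorem UnitaryRep.norm_U_apply (ρ : UnitaryRep.{u, w} X) (x : X) (h : ρ.H) :
    ‖(ρ.U x : ρ.H →L[ℂ] ρ.H) h‖ = ‖h‖ :=
  ContinuousLinearMap.norm_map_of_mem_unitary (ρ.U x).2 h

theorem UnitaryRep.integrable_smul (ρ : UnitaryRep.{u, w} X) (f : C_c(Y, ℂ)) (φ : C(Y, X))
    (h : ρ.H) : Integrable (fun y => f y • (ρ.U (φ y) : ρ.H →L[ℂ] ρ.H) h) μ := by
  refine Continuous.integrable_of_hasCompactSupport ?_ ?_
  · exact f.continuous.smul ((ρ.continuous_U h).comp φ.continuous)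
  · exact f.hasCompactSupport.smul_right

/-- The operator `∫ f(y) U_{φ(y)} dμ(y)`, given on vectors by `h ↦ ∫ f(y) U_{φ(y)} h dμ(y)`. -/
def UnitaryRep.integral (ρ : UnitaryRep.{u, w} X) (f : C_c(Y, ℂ)) (φ : C(Y, X)) :
    ρ.H →L[ℂ] ρ.H :=
  LinearMap.mkContinuous
    { toFun := fun h => ∫ y, f y • (ρ.U (φ y) : ρ.H →L[ℂ] ρ.H) h ∂μ
      map_add' := fun h k => by
        rw [← integral_add (ρ.integrable_smul μ f φ h) (ρ.integrable_smul μ f φ k)]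
        simp only [map_add, smul_add]
      map_smul' := fun c h => by
        rw [RingHom.id_apply, ← integral_smul]
        simp only [map_smul, smul_comm c] }
    (∫ y, ‖f y‖ ∂μ)
    (fun h => by
      refine (norm_integral_le_integral_norm _).trans (le_of_eq ?_)
      simp only [norm_smul, ρ.norm_U_apply]
      exact integral_mul_const _ _)

theorem UnitaryRep.norm_integral_le (ρ : UnitaryRep.{u, w} X) (f : C_c(Y, ℂ)) (φ : C(Y, X)) :
    ‖ρ.integral μ f φ‖ ≤ ∫ y, ‖f y‖ ∂μ :=
  LinearMap.mkContinuous_norm_le _ (integral_nonneg fun _ => norm_nonneg _) _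

/-- The C*-algebra of bounded families `(T_ρ)` of operators `T_ρ ∈ B(H_ρ)`, indexed by all unitary
representations `ρ` of `X` on Hilbert spaces in the universe `w`. -/
abbrev UniversalOperators (X : Type u) [Group X] [TopologicalSpace X] : Type (max u (w + 1)) :=
  lp (fun ρ : UnitaryRep.{u, w} X => ρ.H →L[ℂ] ρ.H) ∞

/-- The element `∫ f(y) δ_{φ(y)} dμ(y)`, where `δ` is the universal unitary representation
`x ↦ (ρ(x))_ρ` of `X`. -/
def universalIntegral (f : C_c(Y, ℂ)) (φ : C(Y, X)) : UniversalOperators.{u, w} X :=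
  ⟨fun ρ => ρ.integral μ f φ, memℓp_infty ⟨∫ y, ‖f y‖ ∂μ, by
    rintro _ ⟨ρ, rfl⟩
    exact ρ.norm_integral_le μ f φ⟩⟩

end integrals

section groupCStar

variable (X : Type u) [Group X] [TopologicalSpace X] [MeasurableSpace X] [OpensMeasurableSpace X]
  (μ : Measure X) [IsFiniteMeasureOnCompacts μ]

/-- The (full) group C*-algebra `C*(X)` of a locally compact group `X` with Haar measure `μ`: the
C*-algebra generated by the elements `∫ f(x) δ_x dμ(x)`, `f ∈ C_c(X)`, where `δ` is the universal
unitary representation. Its norm is the supremum over all unitary representations. (When the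
universe `w` is at least that of `X`, every cyclic representation of `X` is equivalent to one on a
Hilbert space in `w`, so that this is the supremum over all representations whatsoever.) -/
def groupCStarSubalgebra : NonUnitalStarSubalgebra ℂ (UniversalOperators.{u, w} X) :=
  (NonUnitalStarAlgebra.adjoin ℂ
    (Set.range fun f : C_c(X, ℂ) => universalIntegral.{u, u, w} μ f (.id X))).topologicalClosure

/-- The group C*-algebra as a type. -/
def GroupCStar : Type (max u (w + 1)) := groupCStarSubalgebra.{u, w} X μ

instance : NonUnitalCStarAlgebra (GroupCStar.{u, w} X μ) :=
  haveI : IsClosed (groupCStarSubalgebra.{u, w} X μ : Set (UniversalOperators.{u, w} X)) :=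
    NonUnitalStarSubalgebra.isClosed_topologicalClosure _
  inferInstanceAs (NonUnitalCStarAlgebra (groupCStarSubalgebra.{u, w} X μ))

variable {X μ}

/-- The inclusion of `C*(X)` into the bounded families of operators. -/
def GroupCStar.val : GroupCStar.{u, w} X μ →⋆ₙₐ[ℂ] UniversalOperators.{u, w} X :=
  NonUnitalStarSubalgebraClass.subtype (groupCStarSubalgebra.{u, w} X μ)

variable (μ)

/-- The element `f = ∫ f(x) δ_x dμ(x)` of `C*(X)`. -/
def GroupCStar.of (f : C_c(X, ℂ)) : GroupCStar.{u, w} X μ :=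
  ⟨universalIntegral μ f (.id X), NonUnitalStarSubalgebra.le_topologicalClosure _
    (NonUnitalStarAlgebra.subset_adjoin ℂ _ ⟨f, rfl⟩)⟩

end groupCStar

/-! ### Discrete quotient groups -/

section discrete

variable {N : Type u} [Group N]

/-- The quotient group `N / H`, considered as a discrete group. -/
def DiscQuot (H : Subgroup N) : Type u := N ⧸ H

variable (H : Subgroup N) [H.Normal]

instance : Group (DiscQuot H) := inferInstanceAs (Group (N ⧸ H))
instance : TopologicalSpace (DiscQuot H) := ⊥
instance : DiscreteTopology (DiscQuot H) := ⟨rfl⟩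
instance : MeasurableSpace (DiscQuot H) := ⊤
instance : BorelSpace (DiscQuot H) := ⟨borel_eq_top_of_discrete.symm⟩

instance : IsFiniteMeasureOnCompacts (Measure.count : Measure (DiscQuot H)) :=
  ⟨fun _ hK => Measure.count_apply_lt_top.2 hK.finite_of_discrete⟩

/-- The quotient homomorphism `N → N / H`. -/
def DiscQuot.mk : N →* DiscQuot H := QuotientGroup.mk' H

variable {H}

theorem DiscQuot.mk_surjective : Function.Surjective (DiscQuot.mk H) :=
  QuotientGroup.mk'_surjective H

/-- The homomorphism `N / H → N / H'` induced by a homomorphism `f : N → N` with `f(H) ⊆ H'`. -/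
def DiscQuot.map {H' : Subgroup N} [H'.Normal] (f : N →* N) (h : H ≤ H'.comap f) :
    DiscQuot H →* DiscQuot H' := QuotientGroup.map H H' f h

theorem DiscQuot.map_mk {H' : Subgroup N} [H'.Normal] (f : N →* N) (h : H ≤ H'.comap f) (n : N) :
    DiscQuot.map f h (DiscQuot.mk H n) = DiscQuot.mk H' (f n) := rfl

theorem DiscQuot.mk_eq_mk {a b : N} : DiscQuot.mk H a = DiscQuot.mk H b ↔ a⁻¹ * b ∈ H :=
  QuotientGroup.eq

open Classical in
/-- The unitary generator `δ_q` of the C*-algebra of the discrete group `N / H`: the element of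
`C*(N / H)` given by the function with value `1` at `q` and `0` elsewhere (Haar measure is counting
measure). -/
def DiscQuot.delta (q : DiscQuot H) : GroupCStar.{u, w} (DiscQuot H) Measure.count :=
  GroupCStar.of Measure.count
    { toFun := fun x => if x = q then 1 else 0
      continuous_toFun := continuous_of_discreteTopology
      hasCompactSupport' := HasCompactSupport.intro (K := {q}) isCompact_singleton
        (fun _ hx => if_neg hx) }

end discrete

/-! ### The standing assumptions -/

/-- A subsemigroup `S` of a group `G` with `G = S⁻¹S` (that is, an Ore semigroup `S` with its
enveloping group `G`; cancellation and `Ss ∩ St ≠ ∅` are then automatic), an action `ψ` of `G` by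
automorphisms of a group `N`, and a normal subgroup `M` of `N` such that, for all `s ∈ S`,
`M ⊆ ψ_s(M)` and `M / ψ_s⁻¹(M)` is finite, and such that `⋂_{s ∈ S} ψ_s⁻¹(M) = {e}`. -/
structure OreSystem (N : Type u) (G : Type v) [Group N] [Group G] where
  /-- the semigroup -/
  S : Subsemigroup G
  ore : ∀ g : G, ∃ s ∈ S, ∃ t ∈ S, g = s⁻¹ * t
  /-- the action -/
  ψ : G →* MulAut N
  /-- the normal subgroup -/
  M : Subgroup N
  normal : M.Normal
  le_map : ∀ s ∈ S, M ≤ M.map (ψ s).toMonoidHom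
  finite_index : ∀ s ∈ S, ((M.comap (ψ s).toMonoidHom).subgroupOf M).FiniteIndex
  iInf_eq_bot : ⨅ s ∈ S, M.comap (ψ s).toMonoidHom = ⊥

namespace OreSystem

variable {N : Type u} {G : Type v} [Group N] [Group G] (D : OreSystem N G)

instance : D.M.Normal := D.normal

/-- The normal subgroup `ψ_g⁻¹(M)` of `N`. -/
def preM (g : G) : Subgroup N := D.M.comap (D.ψ g).toMonoidHom

instance (g : G) : (D.preM g).Normal :=
  inferInstanceAs (D.M.comap (D.ψ g).toMonoidHom).Normal

theorem mem_preM {g : G} {n : N} : n ∈ D.preM g ↔ D.ψ g n ∈ D.M := Iff.rfl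

theorem mem_of_ψ_mem {s : G} (hs : s ∈ D.S) {n : N} (h : D.ψ s n ∈ D.M) : n ∈ D.M := by
  obtain ⟨m, hm, e⟩ := D.le_map s hs h
  rwa [← (D.ψ s).injective e]

theorem preM_le (s : D.S) : D.preM s ≤ D.M := fun _ h => D.mem_of_ψ_mem s.2 h

theorem preM_mul_le (r s : D.S) : D.preM (r * s : D.S) ≤ D.preM s := by
  intro n h
  rw [mem_preM, MulMemClass.coe_mul, map_mul] at h
  exact D.mem_of_ψ_mem r.2 h

/-- The quotient map `N / ψ_t⁻¹(M) → N / ψ_s⁻¹(M)` for `t = rs`, `r ∈ S`. -/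
def proj (r s : D.S) : DiscQuot (D.preM (r * s : D.S)) →* DiscQuot (D.preM s) :=
  DiscQuot.map (MonoidHom.id N) (D.preM_mul_le r s)

/-- The inverse limit `N_∞ = lim N / ψ_s⁻¹(M)` over `S`, directed by `s ≤ t ↔ t ∈ Ss`: the
group of compatible families in the product of the discrete groups `N / ψ_s⁻¹(M)`. -/
def NInf : Subgroup (∀ s : D.S, DiscQuot (D.preM s)) where
  carrier := {x | ∀ r s : D.S, D.proj r s (x (r * s)) = x s}
  one_mem' := fun r s => map_one (D.proj r s)
  mul_mem' := fun {_ _} hx hy r s => by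
    rw [Pi.mul_apply, Pi.mul_apply, map_mul, hx, hy]
  inv_mem' := fun hx r s => by
    rw [Pi.inv_apply, Pi.inv_apply, map_inv, hx]

/-- The subgroup `K = lim M / ψ_s⁻¹(M)` of `N_∞`. -/
def K : Subgroup D.NInf where
  carrier := {x | ∀ s : D.S, x.1 s ∈ D.M.map (DiscQuot.mk (D.preM s))}
  one_mem' := fun _ => one_mem _
  mul_mem' := fun hx hy s => mul_mem (hx s) (hy s)
  inv_mem' := fun hx s => inv_mem (hx s)

/-- The canonical homomorphism `j : N → N_∞`, `j(n)_s = n ψ_s⁻¹(M)`. -/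
def j : N →* D.NInf where
  toFun n := ⟨fun s => DiscQuot.mk (D.preM s) n, fun _ _ => rfl⟩
  map_one' := rfl
  map_mul' := fun _ _ => rfl

theorem exists_ore (g : G) : ∃ a b : D.S, (b : G) = a * g := by
  obtain ⟨s, hs, t, ht, rfl⟩ := D.ore g
  exact ⟨⟨s, hs⟩, ⟨t, ht⟩, by simp⟩

theorem exists_common (s t : D.S) : ∃ a b : D.S, a * s = b * t := by
  obtain ⟨a, b, h⟩ := D.exists_ore ((s : G) * (t : G)⁻¹)
  exact ⟨a, b, Subtype.ext (by simp [h, mul_assoc])⟩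

theorem NInf_apply_of_mul {x : D.NInf} {r s t : D.S} (ht : t = r * s) {n : N}
    (h : x.1 t = DiscQuot.mk _ n) : x.1 s = DiscQuot.mk _ n := by
  subst ht
  rw [← x.2 r s, h]
  rfl

/-! The topology of `N_∞`. It carries the topology of the inverse limit of the discrete groups
`N / ψ_s⁻¹(M)`, which is the group topology in which `K`, with the profinite topology of
`lim M / ψ_s⁻¹(M)`, is a compact open subgroup. -/

theorem isClosed_NInf : IsClosed (D.NInf : Set (∀ s : D.S, DiscQuot (D.preM s))) := by
  have : (D.NInf : Set (∀ s : D.S, DiscQuot (D.preM s))) =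
      ⋂ r : D.S, ⋂ s : D.S, {x | D.proj r s (x (r * s)) = x s} := by
    ext x
    simp only [Set.mem_iInter]
    rfl
  rw [this]
  refine isClosed_iInter fun r => isClosed_iInter fun s => isClosed_eq ?_ (continuous_apply s)
  exact (continuous_of_discreteTopology (f := D.proj r s)).comp (continuous_apply (r * s))

theorem mem_K_iff (x : D.NInf) (s : D.S) :
    x ∈ D.K ↔ x.1 s ∈ D.M.map (DiscQuot.mk (D.preM s)) := by
  refine ⟨fun h => h s, fun h t => ?_⟩
  obtain ⟨a, b, hab⟩ := D.exists_common s t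
  obtain ⟨n, hn⟩ := DiscQuot.mk_surjective (x.1 (a * s))
  have h1 : x.1 s = DiscQuot.mk _ n := D.NInf_apply_of_mul rfl hn.symm
  have h2 : x.1 t = DiscQuot.mk _ n := D.NInf_apply_of_mul hab hn.symm
  obtain ⟨m, hm, e⟩ := h
  rw [h1, DiscQuot.mk_eq_mk] at e
  rw [h2]
  refine Subgroup.mem_map_of_mem _ ?_
  have := D.M.mul_mem hm (D.preM_le s e)
  rwa [mul_inv_cancel_left] at this

theorem continuous_eval (s : D.S) : Continuous fun x : D.NInf => x.1 s :=
  (continuous_apply s).comp continuous_subtype_val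

theorem isOpen_K : IsOpen (D.K : Set D.NInf) := by
  obtain ⟨s, -, -⟩ := D.exists_ore 1
  have : (D.K : Set D.NInf) = (fun x : D.NInf => x.1 s) ⁻¹'
      (D.M.map (DiscQuot.mk (D.preM s)) : Set (DiscQuot (D.preM s))) := by
    ext x
    exact D.mem_K_iff x s
  rw [this]
  exact (isOpen_discrete _).preimage (D.continuous_eval s)

theorem finite_map_M (s : D.S) :
    (D.M.map (DiscQuot.mk (D.preM s)) : Set (DiscQuot (D.preM s))).Finite := by
  have := D.finite_index s s.2
  let f : D.M →* DiscQuot (D.preM s) := (DiscQuot.mk (D.preM s)).comp D.M.subtype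
  have hker : f.ker = (D.preM s).subgroupOf D.M := by
    ext m
    exact QuotientGroup.eq_one_iff (m : N)
  have h1 : f.ker.FiniteIndex := by rw [hker]; exact this
  have h2 : Finite f.range := by
    have := Finite.of_equiv _ (QuotientGroup.quotientKerEquivRange f).toEquiv
    exact this
  have h3 : D.M.map (DiscQuot.mk (D.preM s)) = f.range := by
    rw [MonoidHom.range_comp, Subgroup.range_subtype]
  rw [h3]
  exact Set.toFinite _

theorem isCompact_K : IsCompact (D.K : Set D.NInf) := by
  rw [Topology.IsEmbedding.subtypeVal.isCompact_iff]
  have : (Subtype.val '' (D.K : Set D.NInf)) =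
      (D.NInf : Set (∀ s : D.S, DiscQuot (D.preM s))) ∩
        Set.univ.pi fun s => (D.M.map (DiscQuot.mk (D.preM s)) : Set (DiscQuot (D.preM s))) := by
    ext x
    constructor
    · rintro ⟨y, hy, rfl⟩
      exact ⟨y.2, fun s _ => hy s⟩
    · rintro ⟨h1, h2⟩
      exact ⟨⟨x, h1⟩, fun s => h2 s trivial, rfl⟩
  rw [this]
  exact (isCompact_univ_pi fun s => (D.finite_map_M s).isCompact).inter_left D.isClosed_NInf

/-- `K` as a compact set with non-empty interior. -/
def KCompact : TopologicalSpace.PositiveCompacts D.NInf where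
  carrier := D.K
  isCompact' := D.isCompact_K
  interior_nonempty' := by
    rw [D.isOpen_K.interior_eq]
    exact ⟨1, one_mem _⟩

instance : LocallyCompactSpace D.NInf := D.KCompact.locallyCompactSpace_of_group

instance : MeasurableSpace D.NInf := borel _
instance : BorelSpace D.NInf := ⟨rfl⟩

/-- The Haar measure of `N_∞` with `μ(K) = 1`. -/
def haarNInf : Measure D.NInf := Measure.haarMeasure D.KCompact

instance : D.haarNInf.IsHaarMeasure := Measure.isHaarMeasure_haarMeasure _

open Classical in
/-- The characteristic function `χ_{xK} ∈ C_c(N_∞)` of a coset of `K`. -/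
def chiCoset (x : D.NInf) : C_c(D.NInf, ℂ) where
  toFun := fun y => if x⁻¹ * y ∈ D.K then 1 else 0
  continuous_toFun := by
    have hcl : IsClopen (D.K : Set D.NInf) := ⟨D.K.isClosed_of_isOpen D.isOpen_K, D.isOpen_K⟩
    have hcl' : IsClopen {y : D.NInf | x⁻¹ * y ∈ D.K} :=
      IsClopen.preimage hcl (continuous_const_mul x⁻¹)
    refine continuous_const.if (fun y hy => ?_) continuous_const
    rw [hcl'.frontier_eq] at hy
    exact hy.elim
  hasCompactSupport' := HasCompactSupport.intro (D.isCompact_K.image (continuous_const_mul x))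
    (fun y hy => if_neg fun h => hy ⟨x⁻¹ * y, h, mul_inv_cancel_left x y⟩)

/-! The action `θ` of `G` on `N_∞`. -/

theorem ψ_mem_preM {g : G} {s a b : D.S} (h : (b : G) = a * (s * g)) :
    D.preM b ≤ (D.preM s).comap (D.ψ g).toMonoidHom := by
  intro n hn
  rw [mem_preM, h, map_mul, map_mul] at hn
  exact D.mem_of_ψ_mem a.2 hn

/-- The map `N / ψ_b⁻¹(M) → N / ψ_s⁻¹(M)` induced by `ψ_g`, for some `b ∈ S ∩ Ssg`. -/
def thetaCoord (g : G) (s : D.S) (x : D.NInf) : DiscQuot (D.preM s) :=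
  DiscQuot.map (D.ψ g).toMonoidHom
    (D.ψ_mem_preM (D.exists_ore (s * g)).choose_spec.choose_spec)
    (x.1 (D.exists_ore (s * g)).choose_spec.choose)

/-- `θ_g(x)_s = ψ_g(x_b)` for every `b ∈ S ∩ Ssg`. -/
theorem thetaCoord_eq {g : G} {s a b : D.S} (h : (b : G) = a * (s * g)) {x : D.NInf} {n : N}
    (hn : x.1 b = DiscQuot.mk _ n) : D.thetaCoord g s x = DiscQuot.mk _ (D.ψ g n) := by
  have hb' := (D.exists_ore (s * g)).choose_spec.choose_spec
  set b' := (D.exists_ore (s * g)).choose_spec.choose with hb'_def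
  obtain ⟨c, d, hcd⟩ := D.exists_common b b'
  obtain ⟨m, hm⟩ := DiscQuot.mk_surjective (x.1 (c * b))
  have h1 : x.1 b = DiscQuot.mk _ m := D.NInf_apply_of_mul rfl hm.symm
  have h2 : x.1 b' = DiscQuot.mk _ m := D.NInf_apply_of_mul hcd hm.symm
  have h3 : D.thetaCoord g s x = DiscQuot.mk _ (D.ψ g m) := by
    unfold thetaCoord
    rw [h2]
    rfl
  rw [h3, DiscQuot.mk_eq_mk, ← map_inv, ← map_mul]
  exact D.ψ_mem_preM h (DiscQuot.mk_eq_mk.1 (h1.symm.trans hn))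

theorem thetaCoord_mem (g : G) (x : D.NInf) : (fun s => D.thetaCoord g s x) ∈ D.NInf := by
  intro r s
  obtain ⟨a, b, h⟩ := D.exists_ore ((r * s : D.S) * g)
  obtain ⟨n, hn⟩ := DiscQuot.mk_surjective (x.1 b)
  have h' : (b : G) = (a * r : D.S) * (s * g) := by simp [h, mul_assoc]
  show D.proj r s (D.thetaCoord g (r * s) x) = D.thetaCoord g s x
  rw [D.thetaCoord_eq h hn.symm, D.thetaCoord_eq h' hn.symm]
  rfl

/-- `θ_g` as an endomorphism. -/
def thetaEnd (g : G) : D.NInf →* D.NInf where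
  toFun x := ⟨fun s => D.thetaCoord g s x, D.thetaCoord_mem g x⟩
  map_one' := Subtype.ext (funext fun _ => map_one (DiscQuot.map _ _))
  map_mul' _ _ := Subtype.ext (funext fun _ => map_mul (DiscQuot.map _ _) _ _)

theorem thetaEnd_one (x : D.NInf) : D.thetaEnd 1 x = x := by
  refine Subtype.ext (funext fun s => ?_)
  obtain ⟨n, hn⟩ := DiscQuot.mk_surjective (x.1 (s * s))
  refine (D.thetaCoord_eq (a := s) (b := s * s) (by simp) hn.symm).trans ?_
  rw [map_one]
  exact (D.NInf_apply_of_mul rfl hn.symm).symm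

theorem thetaEnd_mul (g h : G) (x : D.NInf) :
    D.thetaEnd (g * h) x = D.thetaEnd g (D.thetaEnd h x) := by
  refine Subtype.ext (funext fun s => ?_)
  obtain ⟨a, b, hb⟩ := D.exists_ore (s * g)
  obtain ⟨a', b', hb'⟩ := D.exists_ore (b * h)
  obtain ⟨n, hn⟩ := DiscQuot.mk_surjective (x.1 b')
  have h1 : (D.thetaEnd h x).1 b = DiscQuot.mk _ (D.ψ h n) := D.thetaCoord_eq hb' hn.symm
  have h2 : (b' : G) = (a' * a : D.S) * (s * (g * h)) := by simp [hb, hb', mul_assoc]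
  refine (D.thetaCoord_eq h2 hn.symm).trans ((?_ : _ = _).trans (D.thetaCoord_eq hb h1).symm)
  rw [map_mul]
  rfl

/-- The action `θ` of `G` by automorphisms of `N_∞`. -/
def theta : G →* MulAut D.NInf where
  toFun g :=
    { toFun := D.thetaEnd g
      invFun := D.thetaEnd g⁻¹
      left_inv := fun x => by rw [← thetaEnd_mul, inv_mul_cancel, thetaEnd_one]
      right_inv := fun x => by rw [← thetaEnd_mul, mul_inv_cancel, thetaEnd_one]
      map_mul' := map_mul (D.thetaEnd g) }
  map_one' := MulEquiv.ext D.thetaEnd_one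
  map_mul' g h := MulEquiv.ext (D.thetaEnd_mul g h)

/-- The defining property of `θ`: `π^s ∘ θ_t = ψ_t ∘ π^{st}` for `s, t ∈ S`. -/
theorem theta_apply (s t : D.S) {x : D.NInf} {n : N} (hn : x.1 (s * t) = DiscQuot.mk _ n) :
    (D.theta t x).1 s = DiscQuot.mk _ (D.ψ t n) := by
  obtain ⟨m, hm⟩ := DiscQuot.mk_surjective (x.1 (s * (s * t)))
  have h1 : x.1 (s * t) = DiscQuot.mk _ m := D.NInf_apply_of_mul rfl hm.symm
  refine (D.thetaCoord_eq (a := s) (b := s * (s * t)) (by simp) hm.symm).trans ?_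
  have h2 := DiscQuot.mk_eq_mk.1 (h1.symm.trans hn)
  rw [mem_preM, MulMemClass.coe_mul, map_mul D.ψ, MulAut.mul_apply] at h2
  rw [DiscQuot.mk_eq_mk, ← map_inv, ← map_mul]
  exact h2

theorem continuous_theta (g : G) : Continuous (D.theta g) := by
  refine Continuous.subtype_mk (continuous_pi fun s => ?_) _
  exact (continuous_of_discreteTopology (f := DiscQuot.map _ _)).comp (D.continuous_eval _)

/-- `θ_g` as a continuous map. -/
def thetaC (g : G) : C(D.NInf, D.NInf) := ⟨D.theta g, D.continuous_theta g⟩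

/-! ### The C*-dynamical systems -/

/-- The C*-algebra `C*(N/M)` of the discrete group `N/M`. -/
abbrev CStarQuot : Type (max u v + 1) :=
  GroupCStar.{u, max u v} (DiscQuot D.M) Measure.count

/-- The C*-algebra `C*(N_∞)` of the locally compact group `N_∞`. -/
abbrev CStarNInf : Type (max u v + 1) :=
  GroupCStar.{max u v, max u v} D.NInf D.haarNInf

/-- The homomorphism `mM ↦ ψ_s⁻¹(m)M` of `N/M`, for `s ∈ S`. -/
def invMap (s : D.S) : DiscQuot D.M →* DiscQuot D.M :=
  DiscQuot.map (D.ψ (s : G)⁻¹).toMonoidHom fun m hm => D.mem_of_ψ_mem s.2 (by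
    show D.ψ s (D.ψ (s : G)⁻¹ m) ∈ D.M
    rwa [← MulAut.mul_apply, ← map_mul, mul_inv_cancel, map_one])

/-- `α` is the action of `S` by endomorphisms of `C*(N/M)` such that
`α_s(δ_{nM}) = |M : ψ_s⁻¹(M)|⁻¹ ∑ δ_{mM}`, the sum being over the (finitely many) cosets `mM` with
`ψ_s⁻¹(m)M = nM`. -/
def IsHeckeAction (α : D.S →ₙ* (D.CStarQuot →⋆ₙₐ[ℂ] D.CStarQuot)) : Prop :=
  ∀ (s : D.S) (n : N), α s (DiscQuot.delta (DiscQuot.mk D.M n)) =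
    ((D.preM s).relIndex D.M : ℂ)⁻¹ •
      ∑ᶠ q ∈ {q : DiscQuot D.M | D.invMap s q = DiscQuot.mk D.M n}, DiscQuot.delta q

/-- `β` is the action `θ_*` of `G` by automorphisms of `C*(N_∞)` induced by `θ`:
`(θ_*)_g(∫ f(x) δ_x dμ(x)) = ∫ f(x) δ_{θ_g(x)} dμ(x)` for `f ∈ C_c(N_∞)`. -/
def IsThetaStar (β : G →* (D.CStarNInf ≃⋆ₐ[ℂ] D.CStarNInf)) : Prop :=
  ∀ (g : G) (f : C_c(D.NInf, ℂ)),
    (β g (GroupCStar.of D.haarNInf f)).val = universalIntegral D.haarNInf f (D.thetaC g)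

/-- `i` is the homomorphism with `i(δ_{nM}) = χ_{j(n)K}`. -/
def IsCanonicalEmbedding (i : D.CStarQuot →⋆ₙₐ[ℂ] D.CStarNInf) : Prop :=
  ∀ n : N, i (DiscQuot.delta (DiscQuot.mk D.M n)) =
    GroupCStar.of D.haarNInf (D.chiCoset (D.j n))

end OreSystem

/-- `(B, G, β)` is a minimal automorphic dilation of the semigroup system `(A, S, α)`, with
respect to the embedding `i : A → B`. -/
structure IsMinimalAutomorphicDilation {G : Type v} [Group G] (S : Subsemigroup G)
    {A B : Type w} [NonUnitalCStarAlgebra A] [NonUnitalCStarAlgebra B]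
    (α : S →ₙ* (A →⋆ₙₐ[ℂ] A)) (β : G →* (B ≃⋆ₐ[ℂ] B)) (i : A →⋆ₙₐ[ℂ] B) : Prop where
  injective : Function.Injective i
  intertwines : ∀ (s : S) (a : A), i (α s a) = β s (i a)
  dense : Dense (⋃ s : S, β s ⁻¹' Set.range i)

end

/-! One construction yields both `i` and the `α_s`. Let `π : X → Q` be a continuous surjection onto
a discrete group with compact kernel `L` of positive Haar measure. In a unitary representation of
`X`, integration over `L` is `μ(L)` times the projection onto the `L`-fixed vectors. Since `L` is
normal, `Q` acts unitarily on these vectors. Extending operators by zero on the orthogonal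
complement gives a `*`-homomorphism `C*(Q) → C*(X)` taking `δ_q` to `μ(L)⁻¹` times the
characteristic function of `π⁻¹(q)` (`rep_fiberChar_one`, `inflate_delta`). For `N_∞ → N/M`, with
kernel `K` of mass one, this is `i`. For `mM ↦ ψ_s⁻¹(m)M` on `N/M`, whose kernel has order `|M :
ψ_s⁻¹(M)|`, it is `α_s`.

The automorphisms `(θ_*)_g` come from pulling representations back along `θ_g`. A change of
variables, at the cost of the modulus of `θ_g`, shows that they preserve `C*(N_∞)`.

Injectivity of `i` is seen on representations of `N_∞` inflated from `N/M`, in which `i(a)` acts as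
`a`. For the intertwining relation, `θ_s` maps a coset of `K` onto a finite union of cosets.
Integrating this identity for `K` itself identifies the modulus of `θ_s` with the index occurring in
`α_s`. Multiplicativity of `α` then follows from that of `θ_*`, as `i` is injective.

For density, intertwining makes the subalgebras `(θ_*)_s⁻¹(i(C*(N/M)))` directed. They contain the
characteristic functions of the cosets of the kernels of `x ↦ x_s`. Step functions on such cosets
approximate any `f ∈ C_c(N_∞)` in `L¹`, hence in `C*(N_∞)`. All uniqueness claims hold because
`*`-homomorphisms are determined on generators. -/

noncomputable section

open scoped CStarAlgebra

/-! ### Homomorphisms between algebras of universal operators -/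

namespace UnitaryRep

variable {X : Type u} [Group X] [TopologicalSpace X] {Y : Type v} [Group Y] [TopologicalSpace Y]

/-- The pull-back of a unitary representation along a continuous homomorphism. -/
def comap (ρ : UnitaryRep.{u, w} X) (φ : Y →* X) (hφ : Continuous φ) : UnitaryRep.{v, w} Y where
  H := ρ.H
  U := ρ.U.comp φ
  continuous_U h := (ρ.continuous_U h).comp hφ

theorem integral_apply {Z : Type*} [TopologicalSpace Z] [MeasurableSpace Z]
    [OpensMeasurableSpace Z] (μ : Measure Z) [IsFiniteMeasureOnCompacts μ]
    (ρ : UnitaryRep.{u, w} X) (f : C_c(Z, ℂ)) (φ : C(Z, X)) (h : ρ.H) :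
    ρ.integral μ f φ h = ∫ z, f z • (ρ.U (φ z) : ρ.H →L[ℂ] ρ.H) h ∂μ := rfl

end UnitaryRep

namespace UniversalOperators

section

variable (X : Type u) [Group X] [TopologicalSpace X]

set_option synthInstance.maxHeartbeats 400000

instance : NonUnitalCStarAlgebra (UniversalOperators.{u, w} X) := inferInstance
instance : NonUnitalNormedRing (UniversalOperators.{u, w} X) := inferInstance
instance : NormedAddCommGroup (UniversalOperators.{u, w} X) := inferInstance
instance : NormedSpace ℂ (UniversalOperators.{u, w} X) := inferInstance
instance : Module ℂ (UniversalOperators.{u, w} X) := inferInstance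
instance : StarRing (UniversalOperators.{u, w} X) := inferInstance
instance : Star (UniversalOperators.{u, w} X) := inferInstance
instance : SMul ℂ (UniversalOperators.{u, w} X) := inferInstance
instance : AddCommGroup (UniversalOperators.{u, w} X) := inferInstance
instance : NonUnitalNonAssocSemiring (UniversalOperators.{u, w} X) := inferInstance
instance : MetricSpace (UniversalOperators.{u, w} X) := inferInstance
instance : TopologicalSpace (UniversalOperators.{u, w} X) := inferInstance

end

variable {X : Type u} [Group X] [TopologicalSpace X] {Y : Type v} [Group Y] [TopologicalSpace Y]

/-- A family of `*`-homomorphisms `B(H_{r(ρ)}) → B(H_ρ)`, indexed by the representations `ρ` of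
`X`, induces a `*`-homomorphism between the algebras of universal operators. -/
def reindex (r : UnitaryRep.{u, w} X → UnitaryRep.{v, w} Y)
    (F : ∀ ρ, ((r ρ).H →L[ℂ] (r ρ).H) →⋆ₙₐ[ℂ] (ρ.H →L[ℂ] ρ.H)) :
    UniversalOperators.{v, w} Y →⋆ₙₐ[ℂ] UniversalOperators.{u, w} X where
  toFun T := ⟨fun ρ => F ρ (T (r ρ)), memℓp_infty ⟨‖T‖, by
    rintro _ ⟨ρ, rfl⟩
    exact (NonUnitalStarAlgHom.norm_apply_le (F ρ) _).trans
      (lp.norm_apply_le_norm ENNReal.top_ne_zero T (r ρ))⟩⟩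
  map_smul' c T := lp.ext (funext fun ρ => map_smul (F ρ) c (T (r ρ)))
  map_zero' := lp.ext (funext fun ρ => map_zero (F ρ))
  map_add' S T := lp.ext (funext fun ρ => map_add (F ρ) (S (r ρ)) (T (r ρ)))
  map_mul' S T := lp.ext (funext fun ρ => map_mul (F ρ) (S (r ρ)) (T (r ρ)))
  map_star' T := lp.ext (funext fun ρ => map_star (F ρ) (T (r ρ)))

/-- The `*`-homomorphism `(T_ρ)_ρ ↦ (T_{ρ ∘ φ})_ρ` induced by a continuous homomorphism `φ`. -/
def map (φ : Y →* X) (hφ : Continuous φ) :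
    UniversalOperators.{v, w} Y →⋆ₙₐ[ℂ] UniversalOperators.{u, w} X :=
  reindex (fun ρ => ρ.comap φ hφ) fun _ => NonUnitalStarAlgHom.id ℂ _

end UniversalOperators

/-! ### Linearity and the `L¹` bound for universal integrals -/

section universalIntegral

variable {Y : Type v} [TopologicalSpace Y] [MeasurableSpace Y] [OpensMeasurableSpace Y]
  (μ : Measure Y) [IsFiniteMeasureOnCompacts μ]
  {X : Type u} [Group X] [TopologicalSpace X]

theorem universalIntegral_add (f g : C_c(Y, ℂ)) (φ : C(Y, X)) :
    universalIntegral.{_, _, w} μ (f + g) φ =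
      universalIntegral μ f φ + universalIntegral μ g φ := by
  refine lp.ext (funext fun ρ => ContinuousLinearMap.ext fun h => ?_)
  refine Eq.trans ?_
    (integral_add (ρ.integrable_smul μ f φ h) (ρ.integrable_smul μ g φ h))
  exact integral_congr_ae (.of_forall fun y => add_smul _ _ _)

theorem universalIntegral_smul (c : ℂ) (f : C_c(Y, ℂ)) (φ : C(Y, X)) :
    universalIntegral.{_, _, w} μ (c • f) φ = c • universalIntegral μ f φ := by
  refine lp.ext (funext fun ρ => ContinuousLinearMap.ext fun h => ?_)
  refine Eq.trans ?_ (integral_smul c _)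
  exact integral_congr_ae (.of_forall fun y => smul_assoc c (f y) _)

theorem norm_universalIntegral_le (f : C_c(Y, ℂ)) (φ : C(Y, X)) :
    ‖universalIntegral.{_, _, w} μ f φ‖ ≤ ∫ y, ‖f y‖ ∂μ :=
  lp.norm_le_of_forall_le (integral_nonneg fun _ => norm_nonneg _) fun ρ =>
    ρ.norm_integral_le μ f φ

end universalIntegral

/-! ### Reduction to generators of `C*(X)` -/

namespace GroupCStar

variable {X : Type u} [Group X] [TopologicalSpace X] [MeasurableSpace X] [OpensMeasurableSpace X]
  {μ : Measure X} [IsFiniteMeasureOnCompacts μ]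

theorem val_injective : Function.Injective (val : GroupCStar.{u, w} X μ →⋆ₙₐ[ℂ] _) :=
  Subtype.val_injective

theorem norm_val (a : GroupCStar.{u, w} X μ) : ‖val a‖ = ‖a‖ := rfl

theorem isometry_val : Isometry (val : GroupCStar.{u, w} X μ →⋆ₙₐ[ℂ] _) :=
  AddMonoidHomClass.isometry_of_norm _ norm_val

variable (μ) in
/-- `f ↦ ∫ f(x) δ_x dμ(x)` as a linear map. -/
def ofₗ : C_c(X, ℂ) →ₗ[ℂ] GroupCStar.{u, w} X μ where
  toFun := of μ
  map_add' f g := val_injective (universalIntegral_add μ f g _)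
  map_smul' c f := val_injective (universalIntegral_smul μ c f _)

theorem ofₗ_apply (f : C_c(X, ℂ)) : (ofₗ μ f : GroupCStar.{u, w} X μ) = of μ f := rfl

theorem norm_of_le (f : C_c(X, ℂ)) : ‖(of μ f : GroupCStar.{u, w} X μ)‖ ≤ ∫ x, ‖f x‖ ∂μ :=
  norm_universalIntegral_le μ f _

/-- A closed `*`-subalgebra of `C*(X)` containing the image of `C_c(X)` is everything. -/
theorem mem_of_forall_of_mem (A : NonUnitalStarSubalgebra ℂ (GroupCStar.{u, w} X μ))
    (hA : IsClosed (A : Set (GroupCStar.{u, w} X μ))) (h : ∀ f, of μ f ∈ A) (a) : a ∈ A := by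
  -- `val` is an isometry from a complete space, so the image of `A` is again closed and the
  -- minimality of the topological closure applies to it.
  have hcl : IsClosed (A.map val : Set (UniversalOperators.{u, w} X)) :=
    (isometry_val.isClosedEmbedding).isClosedMap _ hA
  have hle : groupCStarSubalgebra.{u, w} X μ ≤ A.map val := by
    refine NonUnitalStarSubalgebra.topologicalClosure_minimal _ ?_ hcl
    refine NonUnitalStarAlgebra.adjoin_le ?_
    rintro _ ⟨f, rfl⟩
    exact ⟨of μ f, h f, rfl⟩
  obtain ⟨b, hb, e⟩ := hle a.2
  rwa [← val_injective e]

variable {B : Type*} [NonUnitalCStarAlgebra B]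

/-- `*`-homomorphisms of C*-algebras are automatically continuous, so the equalizer is a closed
`*`-subalgebra. -/
theorem hom_ext {F : Type*} [FunLike F (GroupCStar.{u, w} X μ) B]
    [NonUnitalAlgHomClass F ℂ (GroupCStar.{u, w} X μ) B]
    [StarHomClass F (GroupCStar.{u, w} X μ) B] {φ φ' : F}
    (h : ∀ f, φ (of μ f) = φ' (of μ f)) : φ = φ' := by
  refine DFunLike.ext _ _ fun a => ?_
  refine mem_of_forall_of_mem (NonUnitalStarAlgHom.equalizer φ φ') ?_ h a
  exact isClosed_eq (map_continuous φ) (map_continuous φ')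

variable {Y : Type v} [Group Y] [TopologicalSpace Y] [MeasurableSpace Y] [OpensMeasurableSpace Y]
  {ν : Measure Y} [IsFiniteMeasureOnCompacts ν]

theorem apply_val_mem {Φ : UniversalOperators.{v, w} Y →⋆ₙₐ[ℂ] UniversalOperators.{u, w} X}
    (h : ∀ f, ∃ b : GroupCStar.{u, w} X μ, b.val = Φ (of ν f).val) (a : GroupCStar.{v, w} Y ν) :
    Φ a.val ∈ groupCStarSubalgebra.{u, w} X μ := by
  have hcl : IsClosed (groupCStarSubalgebra.{u, w} X μ : Set (UniversalOperators.{u, w} X)) :=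
    NonUnitalStarSubalgebra.isClosed_topologicalClosure _
  refine mem_of_forall_of_mem ((groupCStarSubalgebra.{u, w} X μ).comap (Φ.comp val)) ?_ ?_ a
  · exact hcl.preimage (map_continuous (Φ.comp val))
  · intro f
    obtain ⟨b, hb⟩ := h f
    have := b.2
    change b.val ∈ _ at this
    rwa [hb] at this

/-- A `*`-homomorphism between algebras of universal operators which maps generators of `C*(Y)`
into `C*(X)` restricts to a `*`-homomorphism `C*(Y) → C*(X)`. -/
def restrict (Φ : UniversalOperators.{v, w} Y →⋆ₙₐ[ℂ] UniversalOperators.{u, w} X)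
    (h : ∀ f, ∃ b : GroupCStar.{u, w} X μ, b.val = Φ (of ν f).val) :
    GroupCStar.{v, w} Y ν →⋆ₙₐ[ℂ] GroupCStar.{u, w} X μ :=
  NonUnitalStarAlgHom.codRestrict (Φ.comp val) (groupCStarSubalgebra.{u, w} X μ) (apply_val_mem h)

end GroupCStar

/-! ### Compression to the vectors fixed by a normal subgroup -/

section extendByZero

variable {H : Type*} [NormedAddCommGroup H] [InnerProductSpace ℂ H]
  (V : Submodule ℂ H) [CompleteSpace V]

/-- The embedding `B(V) → B(H)` for a closed subspace `V` of `H`. -/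
def extendByZero [CompleteSpace H] : (V →L[ℂ] V) →⋆ₙₐ[ℂ] (H →L[ℂ] H) where
  toFun T := V.subtypeL ∘L T ∘L V.orthogonalProjectionOnto
  map_smul' c T := by ext h; simp
  map_zero' := by ext h; simp
  map_add' S T := by ext h; simp
  map_mul' S T := by ext h; simp
  map_star' T := by
    simp only [ContinuousLinearMap.star_eq_adjoint, ContinuousLinearMap.adjoint_comp,
      Submodule.adjoint_subtypeL, Submodule.adjoint_orthogonalProjectionOnto,
      ContinuousLinearMap.comp_assoc]

/-- The compression of an operator to a closed subspace. -/
def compress (T : H →L[ℂ] H) : V →L[ℂ] V := V.orthogonalProjectionOnto ∘L T ∘L V.subtypeL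

theorem star_compress [CompleteSpace H] (T : H →L[ℂ] H) :
    star (compress V T) = compress V (star T) := by
  simp only [compress, ContinuousLinearMap.star_eq_adjoint, ContinuousLinearMap.adjoint_comp,
    Submodule.adjoint_subtypeL, Submodule.adjoint_orthogonalProjectionOnto,
    ContinuousLinearMap.comp_assoc]

variable {V}

theorem compress_apply {T : H →L[ℂ] H} (hT : ∀ v ∈ V, T v ∈ V) (v : V) :
    (compress V T v : H) = T v := by
  change ((V.orthogonalProjectionOnto (T v) : V) : H) = T v
  exact V.starProjection_eq_self_iff.2 (hT v v.2)

theorem compress_one : compress V (1 : H →L[ℂ] H) = 1 := by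
  ext v
  exact compress_apply (T := 1) (fun _ => id) v

/-- On invariant subspaces compression is restriction, which respects products; for general
operators this fails. -/
theorem compress_mul {S T : H →L[ℂ] H} (hS : ∀ v ∈ V, S v ∈ V) (hT : ∀ v ∈ V, T v ∈ V) :
    compress V (S * T) = compress V S * compress V T := by
  ext v
  rw [compress_apply (T := S * T) fun v hv => hS _ (hT v hv)]
  change S (T v) = compress V S (compress V T v)
  rw [compress_apply hS, compress_apply hT]

end extendByZero

namespace UnitaryRep

variable {X : Type u} [Group X] [TopologicalSpace X] (ρ : UnitaryRep.{u, w} X) (L : Subgroup X)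

/-- The space of vectors fixed by a subgroup. -/
def fixedSpace : Submodule ℂ ρ.H where
  carrier := {h | ∀ k ∈ L, (ρ.U k : ρ.H →L[ℂ] ρ.H) h = h}
  add_mem' ha hb k hk := by rw [map_add, ha k hk, hb k hk]
  zero_mem' k _ := map_zero _
  smul_mem' c h hh k hk := by rw [map_smul, hh k hk]

theorem mem_fixedSpace {h : ρ.H} :
    h ∈ ρ.fixedSpace L ↔ ∀ k ∈ L, (ρ.U k : ρ.H →L[ℂ] ρ.H) h = h := Iff.rfl

theorem isClosed_fixedSpace : IsClosed (ρ.fixedSpace L : Set ρ.H) := by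
  have : (ρ.fixedSpace L : Set ρ.H) = ⋂ k ∈ L, {h | (ρ.U k : ρ.H →L[ℂ] ρ.H) h = h} := by
    ext h
    simp [mem_fixedSpace]
  rw [this]
  exact isClosed_biInter fun k _ => isClosed_eq (ρ.U k : ρ.H →L[ℂ] ρ.H).continuous continuous_id

instance : CompleteSpace (ρ.fixedSpace L) := (ρ.isClosed_fixedSpace L).completeSpace_coe

theorem U_mul_apply (x y : X) (h : ρ.H) :
    (ρ.U (x * y) : ρ.H →L[ℂ] ρ.H) h =
      (ρ.U x : ρ.H →L[ℂ] ρ.H) ((ρ.U y : ρ.H →L[ℂ] ρ.H) h) := by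
  rw [map_mul]
  rfl

variable {L}

/-- By normality, `U_k U_x = U_x U_{x⁻¹kx}` with `x⁻¹kx ∈ L`. -/
theorem apply_mem_fixedSpace [L.Normal] (x : X) {h : ρ.H} (hh : h ∈ ρ.fixedSpace L) :
    (ρ.U x : ρ.H →L[ℂ] ρ.H) h ∈ ρ.fixedSpace L := by
  intro k hk
  have hk' : x⁻¹ * k * x ∈ L := by
    simpa using Subgroup.Normal.conj_mem ‹L.Normal› k hk x⁻¹
  rw [← U_mul_apply, show k * x = x * (x⁻¹ * k * x) by group, U_mul_apply, hh _ hk']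

variable (L)

/-- The restriction of a representation to the vectors fixed by a normal subgroup. -/
def restrictFixed [L.Normal] : X →* unitary (ρ.fixedSpace L →L[ℂ] ρ.fixedSpace L) where
  toFun x := ⟨compress _ (ρ.U x : ρ.H →L[ℂ] ρ.H), by
    -- The adjoint of `U_x` is `U_{x⁻¹}`, which also preserves the fixed space, so unitarity reduces
    -- to multiplicativity of compression.
    have h1 : (star (ρ.U x : ρ.H →L[ℂ] ρ.H)) = (ρ.U x⁻¹ : ρ.H →L[ℂ] ρ.H) := by
      rw [map_inv]; rfl
    have h2 : ∀ y z : X, compress (ρ.fixedSpace L) (ρ.U y : ρ.H →L[ℂ] ρ.H) *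
        compress (ρ.fixedSpace L) (ρ.U z : ρ.H →L[ℂ] ρ.H) =
          compress (ρ.fixedSpace L) (ρ.U (y * z) : ρ.H →L[ℂ] ρ.H) := fun y z => by
      rw [map_mul, Submonoid.coe_mul,
        compress_mul (fun _ => ρ.apply_mem_fixedSpace y) (fun _ => ρ.apply_mem_fixedSpace z)]
    rw [Unitary.mem_iff, star_compress, h1, h2, h2]
    simp [compress_one]⟩
  map_one' := Subtype.ext (by simp [compress_one])
  map_mul' x y := Subtype.ext (by
    simp only [map_mul, Submonoid.coe_mul]
    exact compress_mul (fun _ => ρ.apply_mem_fixedSpace x) (fun _ => ρ.apply_mem_fixedSpace y))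

theorem restrictFixed_apply [L.Normal] (x : X) (h : ρ.fixedSpace L) :
    (((ρ.restrictFixed L x : ρ.fixedSpace L →L[ℂ] ρ.fixedSpace L) h : ρ.fixedSpace L) : ρ.H) =
      (ρ.U x : ρ.H →L[ℂ] ρ.H) h :=
  compress_apply (fun _ => ρ.apply_mem_fixedSpace x) h

end UnitaryRep

/-! ### Discrete quotients with compact kernel -/

/-- A discrete quotient of a topological group by a compact normal subgroup. -/
structure CompactQuotient (X : Type u) [Group X] [TopologicalSpace X]
    {N : Type v} [Group N] (H : Subgroup N) [H.Normal] where
  /-- the quotient map -/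
  hom : X →* DiscQuot H
  continuous_hom : Continuous hom
  surjective : Function.Surjective hom
  isCompact_ker : IsCompact (hom.ker : Set X)

namespace CompactQuotient

variable {X : Type u} [Group X] [TopologicalSpace X]
  {N : Type v} [Group N] {H : Subgroup N} [H.Normal] (π : CompactQuotient X H)

theorem isClopen_fiber (q : DiscQuot H) : IsClopen {x | π.hom x = q} :=
  (isClopen_discrete {q}).preimage π.continuous_hom

section fiber

variable [IsTopologicalGroup X]

theorem isCompact_fiber (q : DiscQuot H) : IsCompact {x | π.hom x = q} := by
  obtain ⟨x, rfl⟩ := π.surjective q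
  refine (π.isCompact_ker.image (continuous_const_mul x)).of_isClosed_subset
    (π.isClopen_fiber _).1 fun y hy => ⟨x⁻¹ * y, ?_, mul_inv_cancel_left x y⟩
  simp only [Set.mem_ofPred_eq] at hy
  simp [MonoidHom.mem_ker, hy]

open Classical in
/-- The characteristic function of a fibre of the quotient map. -/
def fiberChar (q : DiscQuot H) : C_c(X, ℂ) where
  toFun := fun x => if π.hom x = q then 1 else 0
  continuous_toFun := by
    refine continuous_const.if (fun y hy => ?_) continuous_const
    rw [(π.isClopen_fiber q).frontier_eq] at hy
    exact hy.elim
  hasCompactSupport' := HasCompactSupport.intro (π.isCompact_fiber q) fun _ hy => if_neg hy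

open Classical in
theorem fiberChar_apply (q : DiscQuot H) (x : X) :
    π.fiberChar q x = if π.hom x = q then 1 else 0 := rfl

open Classical in
theorem fiberChar_mul (x y : X) : π.fiberChar (π.hom x) (x * y) = π.fiberChar 1 y := by
  have h : π.hom (x * y) = π.hom x ↔ π.hom y = 1 := by rw [map_mul, mul_eq_left]
  rw [fiberChar_apply, fiberChar_apply]
  exact if_congr h rfl rfl

variable [MeasurableSpace X] [BorelSpace X] (μ : Measure X)

theorem integral_fiberChar (q : DiscQuot H) :
    ∫ x, π.fiberChar q x ∂μ = μ.real {x | π.hom x = q} := by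
  have : (fun x => π.fiberChar q x) = {x | π.hom x = q}.indicator fun _ => (1 : ℂ) := by
    ext x
    by_cases hx : π.hom x = q
    · rw [Set.indicator_of_mem (show x ∈ {x | π.hom x = q} from hx), fiberChar_apply, if_pos hx]
    · rw [Set.indicator_of_notMem (show x ∉ {x | π.hom x = q} from hx), fiberChar_apply, if_neg hx]
  rw [this, integral_indicator_const _ (π.isClopen_fiber q).2.measurableSet]
  simp

variable [μ.IsMulLeftInvariant]

theorem integral_fiberChar_hom (x : X) :
    ∫ y, π.fiberChar (π.hom x) y ∂μ = ∫ y, π.fiberChar 1 y ∂μ := by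
  rw [← integral_mul_left_eq_self _ x]
  simp only [fiberChar_mul]

variable [IsFiniteMeasureOnCompacts μ]

/-- Substitute `y ↦ xy`: left translation by `x` carries the kernel onto the fibre through `x`, and
`U_x` comes out of the integral. -/
theorem rep_fiberChar (ρ : UnitaryRep.{u, w} X) (x : X) (h : ρ.H) :
    ρ.integral μ (π.fiberChar (π.hom x)) (.id X) h =
      (ρ.U x : ρ.H →L[ℂ] ρ.H) (ρ.integral μ (π.fiberChar 1) (.id X) h) := by
  rw [UnitaryRep.integral_apply, UnitaryRep.integral_apply, ← integral_mul_left_eq_self _ x,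
    ← ContinuousLinearMap.integral_comp_comm _ (ρ.integrable_smul μ _ (.id X) h)]
  refine integral_congr_ae (.of_forall fun y => ?_)
  simp only [fiberChar_mul, ContinuousMap.id_apply, UnitaryRep.U_mul_apply, map_smul]

/-- Averaging over the compact kernel projects onto its fixed vectors. The average is fixed by
translation invariance. Its difference from the rescaled `h` is orthogonal to every fixed `w`, since
`⟨w, U_y h⟩ = ⟨U_y w, U_y h⟩ = ⟨w, h⟩` for `y` in the kernel. -/
theorem rep_fiberChar_one (ρ : UnitaryRep.{u, w} X) (h : ρ.H) :
    ρ.integral μ (π.fiberChar 1) (.id X) h =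
      (∫ y, π.fiberChar 1 y ∂μ) • (ρ.fixedSpace π.hom.ker).starProjection h := by
  rw [← map_smul]
  refine (Submodule.eq_starProjection_of_mem_of_inner_eq_zero ?_ fun w hw => ?_).symm
  · intro k hk
    rw [← π.rep_fiberChar μ ρ k h, MonoidHom.mem_ker.1 hk]
  · rw [← inner_conj_symm, inner_sub_right, inner_smul_right, UnitaryRep.integral_apply,
      ← integral_inner (ρ.integrable_smul μ _ (.id X) h), ← integral_mul_const, sub_eq_zero.2,
      map_zero]
    refine integral_congr_ae (.of_forall fun y => ?_)
    simp only [inner_smul_right, fiberChar_apply]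
    split_ifs with hy
    · simp only [one_mul, ContinuousMap.id_apply]
      conv_rhs => rw [← hw y hy]
      exact (ContinuousLinearMap.inner_map_map_of_mem_unitary (ρ.U y).2 w h).symm
    · simp

end fiber

/-- The representation of the discrete quotient on the vectors fixed by the kernel. -/
def fixedRep (ρ : UnitaryRep.{u, w} X) : UnitaryRep.{v, w} (DiscQuot H) where
  H := ρ.fixedSpace π.hom.ker
  U := π.hom.liftOfSurjective π.surjective ⟨ρ.restrictFixed π.hom.ker, fun k hk => by
    rw [MonoidHom.mem_ker]
    ext h
    rw [ρ.restrictFixed_apply]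
    exact h.2 k hk⟩
  continuous_U _ := continuous_of_discreteTopology

theorem fixedRep_U_hom (ρ : UnitaryRep.{u, w} X) (x : X) :
    (π.fixedRep ρ).U (π.hom x) = ρ.restrictFixed π.hom.ker x :=
  MonoidHom.liftOfRightInverse_comp_apply _ _ _ _ _

/-- The map `(T_σ)_σ ↦ (T_{ρ^K} ⊕ 0)_ρ`, where `ρ^K` is the representation of `X / K` on the
vectors fixed by `K`. -/
def inflateOperators :
    UniversalOperators.{v, w} (DiscQuot H) →⋆ₙₐ[ℂ] UniversalOperators.{u, w} X :=
  UniversalOperators.reindex π.fixedRep fun ρ => extendByZero (ρ.fixedSpace π.hom.ker)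

theorem inflateOperators_apply (T : UniversalOperators.{v, w} (DiscQuot H))
    (ρ : UnitaryRep.{u, w} X) :
    π.inflateOperators T ρ = extendByZero (ρ.fixedSpace π.hom.ker) (T (π.fixedRep ρ)) := rfl

end CompactQuotient

/-! ### Group C*-algebras of discrete quotients -/

namespace DiscQuot

variable {N : Type u} [Group N] {H : Subgroup N} [H.Normal]

theorem val_delta_apply (q : DiscQuot H) (σ : UnitaryRep.{u, w} (DiscQuot H)) :
    (delta q : GroupCStar.{u, w} _ _).val σ = (σ.U q : σ.H →L[ℂ] σ.H) := by
  classical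
  ext h
  change ∫ x, (if x = q then (1 : ℂ) else 0) • (σ.U x : σ.H →L[ℂ] σ.H) h ∂Measure.count = _
  have : (fun x => (if x = q then (1 : ℂ) else 0) • (σ.U x : σ.H →L[ℂ] σ.H) h) =
      Set.indicator {q} fun _ => (σ.U q : σ.H →L[ℂ] σ.H) h := by
    ext x
    rw [Set.indicator_apply]
    split_ifs with h1 h2 h2
    · rw [h1, one_smul]
    · exact (h2 h1).elim
    · exact (h1 h2).elim
    · rw [zero_smul]
  rw [this, integral_indicator_const _ (MeasurableSet.of_discrete)]
  simp [Measure.real]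

theorem of_eq_sum (f : C_c(DiscQuot H, ℂ)) (F : Finset (DiscQuot H)) (hF : ∀ q ∉ F, f q = 0) :
    (GroupCStar.of Measure.count f : GroupCStar.{u, w} (DiscQuot H) Measure.count) =
      ∑ q ∈ F, f q • delta q := by
  classical
  simp only [delta, ← GroupCStar.ofₗ_apply, ← map_smul, ← map_sum]
  congr 1
  ext x
  simp only [CompactlySupportedContinuousMap.sum_apply, CompactlySupportedContinuousMap.smul_apply]
  change f x = ∑ q ∈ F, f q • (if x = q then (1 : ℂ) else 0)
  simp only [smul_eq_mul, mul_ite, mul_one, mul_zero, Finset.sum_ite_eq]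
  split_ifs with h
  · rfl
  · exact hF x h

theorem exists_of_eq_sum (f : C_c(DiscQuot H, ℂ)) : ∃ F : Finset (DiscQuot H),
    (GroupCStar.of Measure.count f : GroupCStar.{u, w} (DiscQuot H) Measure.count) =
      ∑ q ∈ F, f q • delta q := by
  have hfin : (tsupport f).Finite := (f.hasCompactSupport : IsCompact _).finite_of_discrete
  refine ⟨hfin.toFinset, of_eq_sum f _ fun q hq => ?_⟩
  rw [Set.Finite.mem_toFinset] at hq
  exact image_eq_zero_of_notMem_tsupport hq

/-- Compactly supported functions on a discrete group are finitely supported, so the `δ_q` span all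
generators. -/
theorem hom_ext {B : Type*} [NonUnitalCStarAlgebra B]
    {φ φ' : GroupCStar.{u, w} (DiscQuot H) Measure.count →⋆ₙₐ[ℂ] B}
    (h : ∀ n : N, φ (delta (mk H n)) = φ' (delta (mk H n))) : φ = φ' := by
  refine GroupCStar.hom_ext fun f => ?_
  obtain ⟨F, hF⟩ := exists_of_eq_sum f
  rw [hF, map_sum, map_sum]
  refine Finset.sum_congr rfl fun q _ => ?_
  obtain ⟨n, rfl⟩ := mk_surjective q
  rw [map_smul, map_smul, h]

end DiscQuot

/-! ### The inflation homomorphism `C*(X / K) → C*(X)` -/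

namespace CompactQuotient

variable {X : Type u} [Group X] [TopologicalSpace X] [IsTopologicalGroup X]
  {N : Type v} [Group N] {H : Subgroup N} [H.Normal] (π : CompactQuotient X H)
  [MeasurableSpace X] [BorelSpace X] (μ : Measure X) [IsFiniteMeasureOnCompacts μ]
  [μ.IsMulLeftInvariant]

/-- In each representation both sides are `μ(K) U_x P`, where `x` lies over `q` and `P` is the
projection onto the vectors fixed by the kernel `K`. -/
theorem integral_smul_inflateOperators_delta (q : DiscQuot H) :
    (∫ y, π.fiberChar 1 y ∂μ) •
      π.inflateOperators (DiscQuot.delta q : GroupCStar.{v, w} _ _).val =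
        (GroupCStar.of μ (π.fiberChar q) : GroupCStar.{u, w} _ _).val := by
  obtain ⟨x, rfl⟩ := π.surjective q
  refine lp.ext (funext fun ρ => ContinuousLinearMap.ext fun h => ?_)
  change (∫ y, π.fiberChar 1 y ∂μ) • π.inflateOperators _ ρ h = ρ.integral μ _ (.id X) h
  rw [π.rep_fiberChar, rep_fiberChar_one, inflateOperators_apply, map_smul]
  congr 1
  have e : (DiscQuot.delta (π.hom x) : GroupCStar.{v, w} _ _).val (π.fixedRep ρ) =
      (ρ.restrictFixed π.hom.ker x : ρ.fixedSpace π.hom.ker →L[ℂ] ρ.fixedSpace π.hom.ker) :=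
    (DiscQuot.val_delta_apply _ _).trans (congrArg Subtype.val (π.fixedRep_U_hom ρ x))
  exact (congrArg (fun T : ρ.fixedSpace π.hom.ker →L[ℂ] ρ.fixedSpace π.hom.ker =>
    extendByZero _ T h) e).trans (ρ.restrictFixed_apply _ _ _)

theorem inflateOperators_delta (hm : ∫ y, π.fiberChar 1 y ∂μ ≠ 0)
    (q : DiscQuot H) :
    π.inflateOperators (DiscQuot.delta q : GroupCStar.{v, w} _ _).val =
      ((∫ y, π.fiberChar 1 y ∂μ)⁻¹ •
        (GroupCStar.of μ (π.fiberChar q) : GroupCStar.{u, w} _ _)).val := by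
  rw [map_smul, ← integral_smul_inflateOperators_delta, inv_smul_smul₀ hm]

theorem exists_val_eq_inflateOperators (hm : ∫ y, π.fiberChar 1 y ∂μ ≠ 0)
    (f : C_c(DiscQuot H, ℂ)) :
    ∃ b : GroupCStar.{u, w} X μ, b.val =
      π.inflateOperators (GroupCStar.of Measure.count f : GroupCStar.{v, w} _ _).val := by
  obtain ⟨F, hF⟩ := DiscQuot.exists_of_eq_sum.{v, w} f
  refine ⟨∑ q ∈ F, f q • (∫ y, π.fiberChar 1 y ∂μ)⁻¹ • GroupCStar.of μ (π.fiberChar q), ?_⟩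
  rw [hF]
  simp only [map_sum]
  refine Finset.sum_congr rfl fun q _ => ?_
  simp only [map_smul]
  rw [inflateOperators_delta π μ hm, map_smul]

/-- The homomorphism `C*(X / K) → C*(X)` with `δ_q ↦ μ(K)⁻¹ χ_q`, where `χ_q` is the characteristic
function of the coset `q` of the compact open normal subgroup `K`. -/
def inflate (hm : ∫ y, π.fiberChar 1 y ∂μ ≠ 0) :
    GroupCStar.{v, w} (DiscQuot H) Measure.count →⋆ₙₐ[ℂ] GroupCStar.{u, w} X μ :=
  GroupCStar.restrict π.inflateOperators (π.exists_val_eq_inflateOperators μ hm)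

theorem inflate_delta (hm : ∫ y, π.fiberChar 1 y ∂μ ≠ 0) (q : DiscQuot H) :
    π.inflate μ hm (DiscQuot.delta q : GroupCStar.{v, w} _ _) =
      (∫ y, π.fiberChar 1 y ∂μ)⁻¹ • (GroupCStar.of μ (π.fiberChar q) : GroupCStar.{u, w} _ _) :=
  GroupCStar.val_injective (π.inflateOperators_delta μ hm q)

end CompactQuotient

namespace OreSystem

variable {N : Type u} {G : Type v} [Group N] [Group G] (D : OreSystem N G)

/-! ### The quotient maps `N_∞ → N / M` and `N / M → N / M` -/

instance : Nonempty D.S := ⟨(D.exists_ore 1).choose⟩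

/-- The quotient map `N_∞ → N / M` with kernel `K`. -/
def toQuot : D.NInf →* DiscQuot D.M :=
  (DiscQuot.map (MonoidHom.id N) (D.preM_le (Classical.arbitrary D.S))).comp
    ((Pi.evalMonoidHom _ (Classical.arbitrary D.S)).comp D.NInf.subtype)

/-- The arbitrary index used in `toQuot` is immaterial: two indices have a common left multiple,
where one representative serves both. -/
theorem toQuot_eq {x : D.NInf} {s : D.S} {n : N} (h : x.1 s = DiscQuot.mk _ n) :
    D.toQuot x = DiscQuot.mk _ n := by
  obtain ⟨a, b, hab⟩ := D.exists_common s (Classical.arbitrary D.S)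
  obtain ⟨m, hm⟩ := DiscQuot.mk_surjective (x.1 (a * s))
  have h1 : x.1 s = DiscQuot.mk _ m := D.NInf_apply_of_mul rfl hm.symm
  have h2 : x.1 (Classical.arbitrary D.S) = DiscQuot.mk _ m := D.NInf_apply_of_mul hab hm.symm
  have h3 : D.toQuot x = DiscQuot.mk _ m := by
    change DiscQuot.map _ (D.preM_le (Classical.arbitrary D.S)) (x.1 (Classical.arbitrary D.S)) = _
    rw [h2]
    rfl
  rw [h3, DiscQuot.mk_eq_mk]
  exact D.preM_le s (DiscQuot.mk_eq_mk.1 (h1.symm.trans h))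

theorem toQuot_j (n : N) : D.toQuot (D.j n) = DiscQuot.mk _ n :=
  D.toQuot_eq (s := Classical.arbitrary D.S) rfl

theorem continuous_toQuot : Continuous D.toQuot :=
  (continuous_of_discreteTopology
    (f := DiscQuot.map _ (D.preM_le (Classical.arbitrary D.S)))).comp (D.continuous_eval _)

theorem ker_toQuot : D.toQuot.ker = D.K := by
  ext x
  obtain ⟨s⟩ : Nonempty D.S := inferInstance
  obtain ⟨n, hn⟩ := DiscQuot.mk_surjective (x.1 s)
  rw [MonoidHom.mem_ker, D.mem_K_iff x s, D.toQuot_eq hn.symm, ← hn]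
  have h1 : DiscQuot.mk D.M n = 1 ↔ n ∈ D.M := QuotientGroup.eq_one_iff n
  rw [h1]
  refine ⟨fun h => Subgroup.mem_map_of_mem _ h, ?_⟩
  rintro ⟨m, hm, e⟩
  have := D.M.mul_mem hm (D.preM_le s (DiscQuot.mk_eq_mk.1 e))
  rwa [mul_inv_cancel_left] at this

/-- `N_∞ → N / M` as a discrete quotient with compact kernel. -/
def quotNInf : CompactQuotient D.NInf D.M where
  hom := D.toQuot
  continuous_hom := D.continuous_toQuot
  surjective q := by
    obtain ⟨n, rfl⟩ := DiscQuot.mk_surjective q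
    exact ⟨D.j n, D.toQuot_j n⟩
  isCompact_ker := by
    rw [ker_toQuot]
    exact D.isCompact_K

theorem chiCoset_eq (x : D.NInf) : D.chiCoset x = D.quotNInf.fiberChar (D.toQuot x) := by
  classical
  ext y
  change (if x⁻¹ * y ∈ D.K then (1 : ℂ) else 0) = if D.toQuot y = D.toQuot x then (1 : ℂ) else 0
  refine if_congr ?_ rfl rfl
  rw [← ker_toQuot, MonoidHom.mem_ker, map_mul, map_inv, inv_mul_eq_one, eq_comm]

theorem integral_fiberChar_quotNInf (q : DiscQuot D.M) :
    ∫ x, D.quotNInf.fiberChar q x ∂D.haarNInf = 1 := by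
  obtain ⟨x, rfl⟩ := D.quotNInf.surjective q
  rw [CompactQuotient.integral_fiberChar_hom, CompactQuotient.integral_fiberChar]
  have : {x | D.quotNInf.hom x = 1} = (D.KCompact : Set D.NInf) := by
    change (D.toQuot.ker : Set D.NInf) = D.K
    rw [ker_toQuot]
  rw [this, Measure.real, haarNInf, Measure.haarMeasure_self]
  simp

/-- The kernel is `ψ_s(M)/M`, and `ψ_s` carries the pair `ψ_s⁻¹(M) ⊆ M` to `M ⊆ ψ_s(M)`, so the
indices agree. -/
theorem relIndex_eq_card_ker (s : D.S) :
    (D.preM s).relIndex D.M = Nat.card (D.invMap s).ker := by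
  have h1 : D.M.map (D.ψ s).toMonoidHom = D.preM (s : G)⁻¹ := by
    rw [preM, map_inv]
    exact Subgroup.map_equiv_eq_comap_symm (D.ψ s) D.M
  have h2 : (D.preM (s : G)⁻¹).map (DiscQuot.mk D.M) = (D.invMap s).ker := by
    ext q
    obtain ⟨n, rfl⟩ := DiscQuot.mk_surjective q
    have h3 : DiscQuot.mk D.M n ∈ (D.invMap s).ker ↔ D.ψ (s : G)⁻¹ n ∈ D.M :=
      QuotientGroup.eq_one_iff _
    rw [h3]
    constructor
    · rintro ⟨m, hm, e⟩
      exact h3.1 (e ▸ (QuotientGroup.eq_one_iff _).2 hm)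
    · exact fun h => ⟨n, h, rfl⟩
  have h4 : (DiscQuot.mk D.M).ker = D.M := QuotientGroup.ker_mk' D.M
  rw [preM, Subgroup.relIndex_comap, h1, ← h2, ← Subgroup.relIndex_ker, h4]

theorem relIndex_ne_zero (s : D.S) : (D.preM s).relIndex D.M ≠ 0 :=
  have := D.finite_index s s.2
  Subgroup.FiniteIndex.index_ne_zero (H := (D.M.comap (D.ψ s).toMonoidHom).subgroupOf D.M)

theorem finite_ker_invMap (s : D.S) : Finite (D.invMap s).ker :=
  Nat.finite_of_card_ne_zero (D.relIndex_eq_card_ker s ▸ D.relIndex_ne_zero s)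

theorem invMap_mk_ψ (s : D.S) (n : N) :
    D.invMap s (DiscQuot.mk _ (D.ψ s n)) = DiscQuot.mk _ n := by
  change DiscQuot.mk _ (D.ψ (s : G)⁻¹ (D.ψ s n)) = _
  rw [← MulAut.mul_apply, ← map_mul, inv_mul_cancel, map_one, MulAut.one_apply]

/-- The map `mM ↦ ψ_s⁻¹(m)M` as a discrete quotient with compact kernel. -/
def quotInv (s : D.S) : CompactQuotient (DiscQuot D.M) D.M where
  hom := D.invMap s
  continuous_hom := continuous_of_discreteTopology
  surjective q := by
    obtain ⟨n, rfl⟩ := DiscQuot.mk_surjective q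
    exact ⟨_, D.invMap_mk_ψ s n⟩
  isCompact_ker :=
    have := D.finite_ker_invMap s
    (Set.toFinite _).isCompact

theorem finite_fiber_invMap (s : D.S) (q : DiscQuot D.M) :
    {p : DiscQuot D.M | D.invMap s p = q}.Finite :=
  ((D.quotInv s).isCompact_fiber q).finite_of_discrete

/-- The finite set of cosets `mM` with `ψ_s⁻¹(m)M = q`. -/
def fiber (s : D.S) (q : DiscQuot D.M) : Finset (DiscQuot D.M) :=
  (D.finite_fiber_invMap s q).toFinset

theorem mem_fiber {s : D.S} {p q : DiscQuot D.M} : p ∈ D.fiber s q ↔ D.invMap s p = q :=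
  (D.finite_fiber_invMap s q).mem_toFinset

theorem card_fiber_one (s : D.S) : (D.fiber s 1).card = (D.preM s).relIndex D.M := by
  rw [relIndex_eq_card_ker, fiber, ← Set.ncard_eq_toFinset_card _ (D.finite_fiber_invMap s 1)]
  rfl

theorem integral_fiberChar_quotInv (s : D.S) :
    ∫ q, (D.quotInv s).fiberChar 1 q ∂Measure.count = (D.preM s).relIndex D.M := by
  rw [CompactQuotient.integral_fiberChar, ← card_fiber_one, Measure.real]
  have h : {q | (D.quotInv s).hom q = 1} = (D.fiber s 1 : Set (DiscQuot D.M)) := by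
    ext q
    rw [Finset.mem_coe, mem_fiber]
    rfl
  rw [h, Measure.count_apply_finset]
  simp

theorem of_fiberChar_quotInv (s : D.S) (q : DiscQuot D.M) :
    (GroupCStar.of Measure.count ((D.quotInv s).fiberChar q) : D.CStarQuot) =
      ∑ p ∈ D.fiber s q, DiscQuot.delta p := by
  rw [DiscQuot.of_eq_sum _ (D.fiber s q)]
  · refine Finset.sum_congr rfl fun p hp => ?_
    rw [CompactQuotient.fiberChar_apply,
      if_pos (show (D.quotInv s).hom p = q from D.mem_fiber.1 hp), one_smul]
  · intro p hp
    rw [CompactQuotient.fiberChar_apply,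
      if_neg fun h : (D.quotInv s).hom p = q => hp (D.mem_fiber.2 h)]

theorem toQuot_theta (s : D.S) {x : D.NInf} {n : N} (h : x.1 s = DiscQuot.mk _ n) :
    D.toQuot (D.theta s x) = DiscQuot.mk _ (D.ψ s n) := by
  obtain ⟨m, hm⟩ := DiscQuot.mk_surjective (x.1 (s * s))
  rw [D.toQuot_eq (D.theta_apply s s hm.symm), DiscQuot.mk_eq_mk, ← map_inv, ← map_mul]
  exact DiscQuot.mk_eq_mk.1 ((D.NInf_apply_of_mul rfl hm.symm).symm.trans h)

theorem invMap_toQuot_theta (s : D.S) (x : D.NInf) :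
    D.invMap s (D.toQuot (D.theta s x)) = D.toQuot x := by
  obtain ⟨n, hn⟩ := DiscQuot.mk_surjective (x.1 s)
  rw [D.toQuot_theta s hn.symm, invMap_mk_ψ, D.toQuot_eq hn.symm]

/-- The composite `N_∞ → N/M` of `θ_s` with the quotient map factors through `x_s` by the injective
map `nψ_s⁻¹(M) ↦ ψ_s(n)M`. Fibres of `x ↦ x_s` are thus preimages under `θ_s` of cosets of `K`. -/
theorem eq_of_toQuot_theta_eq (s : D.S) {x y : D.NInf}
    (h : D.toQuot (D.theta s x) = D.toQuot (D.theta s y)) : x.1 s = y.1 s := by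
  obtain ⟨n, hn⟩ := DiscQuot.mk_surjective (x.1 s)
  obtain ⟨m, hm⟩ := DiscQuot.mk_surjective (y.1 s)
  rw [D.toQuot_theta s hn.symm, D.toQuot_theta s hm.symm, DiscQuot.mk_eq_mk, ← map_inv,
    ← map_mul] at h
  rw [← hn, ← hm]
  exact DiscQuot.mk_eq_mk.2 h

/-! ### The action `θ_*` -/

theorem theta_inv_theta (g : G) (x : D.NInf) : D.theta g⁻¹ (D.theta g x) = x :=
  (D.theta g).symm_apply_apply x

theorem theta_theta_inv (g : G) (x : D.NInf) : D.theta g (D.theta g⁻¹ x) = x :=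
  (D.theta g).apply_symm_apply x

/-- `θ_g` as an automorphism of topological groups. -/
def thetaEquiv (g : G) : D.NInf ≃ₜ* D.NInf where
  toMulEquiv := D.theta g
  continuous_toFun := D.continuous_theta g
  continuous_invFun := D.continuous_theta g⁻¹

/-- The function `f ∘ θ_g`. -/
def pull (g : G) (f : C_c(D.NInf, ℂ)) : C_c(D.NInf, ℂ) where
  toContinuousMap := f.toContinuousMap.comp (D.thetaC g)
  hasCompactSupport' := f.hasCompactSupport.comp_homeomorph (D.thetaEquiv g).toHomeomorph

theorem pull_apply (g : G) (f : C_c(D.NInf, ℂ)) (x : D.NInf) : D.pull g f x = f (D.theta g x) := rfl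

theorem pull_pull_inv (g : G) (f : C_c(D.NInf, ℂ)) : D.pull g⁻¹ (D.pull g f) = f := by
  ext x
  rw [pull_apply, pull_apply, theta_theta_inv]

instance : D.haarNInf.Regular := inferInstanceAs (Measure.haarMeasure D.KCompact).Regular

/-- Change of variables; it also fixes the normalisation of the modulus: `θ_g` multiplies volumes by
`mulEquivHaarChar`. -/
theorem haarChar_smul_integral (g : G) {E : Type*} [NormedAddCommGroup E] [NormedSpace ℝ E]
    (F : D.NInf → E) :
    mulEquivHaarChar (D.thetaEquiv g) • ∫ x, F (D.theta g x) ∂D.haarNInf =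
      ∫ x, F x ∂D.haarNInf := by
  conv_rhs => rw [← mulEquivHaarChar_smul_map D.haarNInf (D.thetaEquiv g),
    integral_smul_nnreal_measure]
  congr 1
  exact ((D.thetaEquiv g).toHomeomorph.isClosedEmbedding.measurableEmbedding.integral_map F).symm

theorem haarChar_smul_universalIntegral (g : G) (f : C_c(D.NInf, ℂ)) :
    ((mulEquivHaarChar (D.thetaEquiv g) : ℝ) : ℂ) •
      universalIntegral.{_, _, w} D.haarNInf f (D.thetaC g) =
        (GroupCStar.of D.haarNInf (D.pull g⁻¹ f)).val := by
  refine lp.ext (funext fun ρ => ContinuousLinearMap.ext fun h => ?_)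
  refine Eq.trans ?_ (D.haarChar_smul_integral g fun x =>
    f (D.theta g⁻¹ x) • (ρ.U x : ρ.H →L[ℂ] ρ.H) h)
  simp only [theta_inv_theta]
  exact Complex.coe_smul _ _

theorem haarChar_ne_zero (g : G) : ((mulEquivHaarChar (D.thetaEquiv g) : ℝ) : ℂ) ≠ 0 :=
  Complex.ofReal_ne_zero.2 (NNReal.coe_ne_zero.2 (mulEquivHaarChar_pos _).ne')

/-- This keeps `θ_*` inside `C*(N_∞)`: the transported integral is a multiple of the generator given
by `f ∘ θ_g⁻¹`. -/
theorem universalIntegral_thetaC (g : G) (f : C_c(D.NInf, ℂ)) :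
    universalIntegral.{_, _, w} D.haarNInf f (D.thetaC g) =
      (((mulEquivHaarChar (D.thetaEquiv g) : ℝ) : ℂ)⁻¹ •
        GroupCStar.of D.haarNInf (D.pull g⁻¹ f)).val := by
  rw [map_smul, ← haarChar_smul_universalIntegral, inv_smul_smul₀ (D.haarChar_ne_zero g)]

/-- The endomorphism of `C*(N_∞)` induced by `θ_g`. -/
def thetaHom (g : G) : D.CStarNInf →⋆ₙₐ[ℂ] D.CStarNInf :=
  GroupCStar.restrict (UniversalOperators.map (D.theta g).toMonoidHom (D.continuous_theta g))
    fun f => ⟨_, (D.universalIntegral_thetaC g f).symm⟩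

theorem val_thetaHom_of (g : G) (f : C_c(D.NInf, ℂ)) :
    (D.thetaHom g (GroupCStar.of D.haarNInf f)).val =
      universalIntegral D.haarNInf f (D.thetaC g) := rfl

theorem thetaHom_one (a : D.CStarNInf) : D.thetaHom 1 a = a := by
  have h : D.thetaHom 1 = NonUnitalStarAlgHom.id ℂ _ := GroupCStar.hom_ext fun f => by
    apply GroupCStar.val_injective
    rw [val_thetaHom_of]
    have : D.thetaC 1 = .id _ := ContinuousMap.ext D.thetaEnd_one
    rw [this]
    rfl
  rw [h]
  rfl

theorem thetaHom_mul (g h : G) (a : D.CStarNInf) :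
    D.thetaHom (g * h) a = D.thetaHom g (D.thetaHom h a) := by
  have e : D.thetaHom (g * h) = (D.thetaHom g).comp (D.thetaHom h) :=
    GroupCStar.hom_ext fun f => by
      apply GroupCStar.val_injective
      have : D.thetaC (g * h) = (D.thetaC g).comp (D.thetaC h) :=
        ContinuousMap.ext (D.thetaEnd_mul g h)
      rw [val_thetaHom_of, this]
      rfl
  rw [e]
  rfl

/-- The action `θ_*` of `G` on `C*(N_∞)`. -/
def thetaStar : G →* (D.CStarNInf ≃⋆ₐ[ℂ] D.CStarNInf) where
  toFun g :=
    { toFun := D.thetaHom g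
      invFun := D.thetaHom g⁻¹
      left_inv a := by rw [← thetaHom_mul, inv_mul_cancel, thetaHom_one]
      right_inv a := by rw [← thetaHom_mul, mul_inv_cancel, thetaHom_one]
      map_mul' := map_mul (D.thetaHom g)
      map_add' := map_add (D.thetaHom g)
      map_smul' := map_smul (D.thetaHom g)
      map_star' := map_star (D.thetaHom g) }
  map_one' := StarAlgEquiv.ext D.thetaHom_one
  map_mul' g h := StarAlgEquiv.ext (D.thetaHom_mul g h)

theorem isThetaStar_thetaStar : D.IsThetaStar D.thetaStar := D.val_thetaHom_of

/-! ### The embedding `i` and the endomorphisms `α_s` -/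

/-- The embedding `C*(N/M) → C*(N_∞)`. -/
def embedding : D.CStarQuot →⋆ₙₐ[ℂ] D.CStarNInf :=
  D.quotNInf.inflate D.haarNInf (by rw [integral_fiberChar_quotNInf]; exact one_ne_zero)

theorem embedding_delta (q : DiscQuot D.M) :
    D.embedding (DiscQuot.delta q) = GroupCStar.of D.haarNInf (D.quotNInf.fiberChar q) := by
  rw [embedding, CompactQuotient.inflate_delta, integral_fiberChar_quotNInf, inv_one, one_smul]

theorem isCanonicalEmbedding_embedding : D.IsCanonicalEmbedding D.embedding := fun n => by
  rw [embedding_delta, chiCoset_eq, toQuot_j]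

/-- The endomorphism `α_s` of `C*(N/M)`. -/
def heckeHom (s : D.S) : D.CStarQuot →⋆ₙₐ[ℂ] D.CStarQuot :=
  (D.quotInv s).inflate Measure.count (by
    rw [integral_fiberChar_quotInv]
    exact Nat.cast_ne_zero.2 (D.relIndex_ne_zero s))

theorem heckeHom_delta (s : D.S) (q : DiscQuot D.M) :
    D.heckeHom s (DiscQuot.delta q) =
      ((D.preM s).relIndex D.M : ℂ)⁻¹ • ∑ p ∈ D.fiber s q, DiscQuot.delta p := by
  rw [heckeHom, CompactQuotient.inflate_delta, integral_fiberChar_quotInv, of_fiberChar_quotInv]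

theorem finsum_delta (s : D.S) (q : DiscQuot D.M) :
    ∑ᶠ p ∈ {p : DiscQuot D.M | D.invMap s p = q}, (DiscQuot.delta p : D.CStarQuot) =
      ∑ p ∈ D.fiber s q, DiscQuot.delta p :=
  finsum_mem_eq_finite_toFinset_sum _ (D.finite_fiber_invMap s q)

variable {D}

theorem IsCanonicalEmbedding.eq_embedding {i : D.CStarQuot →⋆ₙₐ[ℂ] D.CStarNInf}
    (hi : D.IsCanonicalEmbedding i) : i = D.embedding :=
  DiscQuot.hom_ext fun n => by rw [hi, D.isCanonicalEmbedding_embedding]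

theorem IsHeckeAction.eq_heckeHom {α : D.S →ₙ* (D.CStarQuot →⋆ₙₐ[ℂ] D.CStarQuot)}
    (hα : D.IsHeckeAction α) (s : D.S) : α s = D.heckeHom s :=
  DiscQuot.hom_ext fun n => by rw [hα, finsum_delta, heckeHom_delta]

theorem IsThetaStar.eq_thetaStar {β : G →* (D.CStarNInf ≃⋆ₐ[ℂ] D.CStarNInf)}
    (hβ : D.IsThetaStar β) : β = D.thetaStar :=
  MonoidHom.ext fun g => GroupCStar.hom_ext fun f => GroupCStar.val_injective <| by
    rw [hβ, D.isThetaStar_thetaStar]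

variable (D)

/-! ### Injectivity of the embedding -/

/-- A left inverse of `i`. In a representation of `N_∞` pulled back from `N/M`, the integrand
`χ_{j(n)K}(x) U_x` is constantly `U_{nM}` on a set of mass one, so `i(δ_{nM})` acts as `δ_{nM}`. -/
theorem val_eq_map_embedding (a : D.CStarQuot) :
    a.val = UniversalOperators.map D.toQuot D.continuous_toQuot (D.embedding a).val := by
  have h : (GroupCStar.val : D.CStarQuot →⋆ₙₐ[ℂ] _) =
      (UniversalOperators.map D.toQuot D.continuous_toQuot).comp
        (GroupCStar.val.comp D.embedding) := by
    refine DiscQuot.hom_ext fun n => lp.ext (funext fun ρ => ?_)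
    rw [DiscQuot.val_delta_apply]
    change _ = (D.embedding (DiscQuot.delta (DiscQuot.mk D.M n))).val
      (ρ.comap D.toQuot D.continuous_toQuot)
    rw [embedding_delta]
    ext h
    change _ = ∫ x, D.quotNInf.fiberChar (DiscQuot.mk D.M n) x •
      (ρ.U (D.toQuot x) : ρ.H →L[ℂ] ρ.H) h ∂D.haarNInf
    have e : ∀ x, D.quotNInf.fiberChar (DiscQuot.mk D.M n) x •
        (ρ.U (D.toQuot x) : ρ.H →L[ℂ] ρ.H) h = D.quotNInf.fiberChar (DiscQuot.mk D.M n) x •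
          (ρ.U (DiscQuot.mk D.M n) : ρ.H →L[ℂ] ρ.H) h := fun x => by
      rw [CompactQuotient.fiberChar_apply]
      split_ifs with hx
      · rw [← hx]
        rfl
      · rw [zero_smul, zero_smul]
    simp only [e]
    rw [integral_smul_const, integral_fiberChar_quotNInf, one_smul]
  exact DFunLike.congr_fun h a

theorem embedding_injective : Function.Injective D.embedding := fun a b h =>
  GroupCStar.val_injective (by rw [val_eq_map_embedding, h, ← val_eq_map_embedding])

/-! ### The intertwining relation -/

/-- The left side is the characteristic function of the image under `θ_s` of a coset of `K`. Since
`invMap s` undoes `θ_s` modulo `K`, that image is the union of the cosets over the fibre of `q`. -/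
theorem pull_inv_fiberChar (s : D.S) (q : DiscQuot D.M) :
    D.pull (s : G)⁻¹ (D.quotNInf.fiberChar q) =
      ∑ p ∈ D.fiber s q, D.quotNInf.fiberChar p := by
  classical
  ext x
  rw [CompactlySupportedContinuousMap.sum_apply, pull_apply]
  simp only [CompactQuotient.fiberChar_apply]
  rw [Finset.sum_ite_eq]
  refine if_congr ?_ rfl rfl
  rw [mem_fiber]
  have := D.invMap_toQuot_theta s (D.theta (s : G)⁻¹ x)
  rw [theta_theta_inv] at this
  exact ⟨fun h => this.trans h, fun h => this.symm.trans h⟩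

/-- Compare volumes in the decomposition of `θ_s(K)` into cosets of `K`, each of mass one; their
number is the index. -/
theorem haarChar_eq (s : D.S) :
    ((mulEquivHaarChar (D.thetaEquiv s) : ℝ) : ℂ) = (D.preM s).relIndex D.M := by
  have h := D.haarChar_smul_integral s fun x => D.pull (s : G)⁻¹ (D.quotNInf.fiberChar 1) x
  simp only [pull_apply, theta_inv_theta] at h
  simp only [← pull_apply] at h
  rw [integral_fiberChar_quotNInf, pull_inv_fiberChar] at h
  simp only [CompactlySupportedContinuousMap.sum_apply] at h
  have hint : ∀ p, Integrable (fun x => D.quotNInf.fiberChar p x) D.haarNInf := fun p =>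
    (D.quotNInf.fiberChar p).continuous.integrable_of_hasCompactSupport
      (D.quotNInf.fiberChar p).hasCompactSupport
  rw [integral_finsetSum _ fun p _ => hint p] at h
  simp only [integral_fiberChar_quotNInf, Finset.sum_const, card_fiber_one] at h
  rw [nsmul_eq_mul, mul_one] at h
  rw [← h]
  simp [NNReal.smul_def]

theorem thetaStar_of (g : G) (f : C_c(D.NInf, ℂ)) :
    D.thetaStar g (GroupCStar.of D.haarNInf f) =
      ((mulEquivHaarChar (D.thetaEquiv g) : ℝ) : ℂ)⁻¹ •
        GroupCStar.of D.haarNInf (D.pull g⁻¹ f) :=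
  GroupCStar.val_injective ((D.isThetaStar_thetaStar g f).trans (D.universalIntegral_thetaC g f))

theorem embedding_heckeHom (s : D.S) (a : D.CStarQuot) :
    D.embedding (D.heckeHom s a) = D.thetaStar s (D.embedding a) := by
  have h : D.embedding.comp (D.heckeHom s) = (D.thetaHom s).comp D.embedding := by
    refine DiscQuot.hom_ext fun n => ?_
    change D.embedding (D.heckeHom s _) = D.thetaStar s (D.embedding _)
    rw [heckeHom_delta, embedding_delta, thetaStar_of, haarChar_eq, pull_inv_fiberChar,
      map_smul, map_sum]
    simp only [embedding_delta, ← GroupCStar.ofₗ_apply, map_sum]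
  exact DFunLike.congr_fun h a

/-- The action `α` of `S` on `C*(N/M)`. -/
def heckeAction : D.S →ₙ* (D.CStarQuot →⋆ₙₐ[ℂ] D.CStarQuot) where
  toFun := D.heckeHom
  map_mul' s t := by
    ext a
    -- After applying the injective `i`, the identity `α_{st} = α_s α_t` becomes multiplicativity of
    -- `θ_*`.
    apply D.embedding_injective
    change D.embedding (D.heckeHom (s * t) a) = D.embedding (D.heckeHom s (D.heckeHom t a))
    rw [embedding_heckeHom, embedding_heckeHom, embedding_heckeHom, MulMemClass.coe_mul, map_mul]
    rfl

theorem isHeckeAction_heckeAction : D.IsHeckeAction D.heckeAction := fun s n => by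
  rw [finsum_delta]
  exact D.heckeHom_delta s _

/-! ### Density -/

theorem exists_upper_bound (I : Finset D.S) : ∃ t : D.S, ∀ s ∈ I, ∃ r, t = r * s := by
  classical
  induction I using Finset.induction_on with
  | empty => exact ⟨Classical.arbitrary _, by simp⟩
  | insert s I _ ih =>
    obtain ⟨t, ht⟩ := ih
    obtain ⟨a, b, hab⟩ := D.exists_common s t
    refine ⟨a * s, fun s' hs' => ?_⟩
    rcases Finset.mem_insert.1 hs' with rfl | h
    · exact ⟨a, rfl⟩
    · obtain ⟨r, rfl⟩ := ht s' h
      exact ⟨b * r, by rw [hab, mul_assoc]⟩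

theorem apply_eq_of_mul {x y : D.NInf} {t s : D.S} (h : ∃ r, t = r * s) (e : x.1 t = y.1 t) :
    x.1 s = y.1 s := by
  obtain ⟨r, hr⟩ := h
  obtain ⟨n, hn⟩ := DiscQuot.mk_surjective (x.1 t)
  rw [D.NInf_apply_of_mul hr hn.symm, D.NInf_apply_of_mul hr (e.symm.trans hn.symm)]

/-- A basic neighbourhood restricts finitely many coordinates, and one coordinate beyond all of them
determines these. -/
theorem exists_forall_apply_eq_mem {x : D.NInf} {U : Set D.NInf} (hU : U ∈ nhds x) :
    ∃ s : D.S, ∀ y : D.NInf, x.1 s = y.1 s → y ∈ U := by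
  obtain ⟨V, hVU, hV, hxV⟩ := mem_nhds_iff.1 hU
  obtain ⟨W, hW, rfl⟩ := isOpen_induced_iff.1 hV
  obtain ⟨I, u, hu, hI⟩ := isOpen_pi_iff.1 hW _ hxV
  obtain ⟨t, ht⟩ := D.exists_upper_bound I
  refine ⟨t, fun y hy => hVU (hI fun s hs => ?_)⟩
  rw [← D.apply_eq_of_mul (ht s hs) hy]
  exact (hu s hs).2

/-- Uniform continuity: compactness of the support gives one index `s` for all its points, and `f`
vanishes elsewhere. -/
theorem exists_norm_sub_lt (f : C_c(D.NInf, ℂ)) {δ : ℝ} (hδ : 0 < δ) :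
    ∃ s : D.S, ∀ x y : D.NInf, x.1 s = y.1 s → ‖f x - f y‖ < δ := by
  have key : ∃ s : D.S, ∀ x ∈ tsupport f, ∀ y : D.NInf, x.1 s = y.1 s → ‖f x - f y‖ < δ := by
    refine IsCompact.induction_on (p := fun A => ∃ s : D.S, ∀ x ∈ A, ∀ y : D.NInf,
      x.1 s = y.1 s → ‖f x - f y‖ < δ) f.hasCompactSupport ?_ ?_ ?_ ?_
    · exact ⟨Classical.arbitrary _, by simp⟩
    · rintro A B hAB ⟨s, hs⟩
      exact ⟨s, fun x hx => hs x (hAB hx)⟩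
    · rintro A B ⟨s, hs⟩ ⟨t, ht⟩
      obtain ⟨a, b, hab⟩ := D.exists_common s t
      refine ⟨a * s, fun x hx y hxy => ?_⟩
      rcases hx with hx | hx
      · exact hs x hx y (D.apply_eq_of_mul ⟨a, rfl⟩ hxy)
      · exact ht x hx y (D.apply_eq_of_mul ⟨b, hab⟩ hxy)
    · intro x _
      obtain ⟨s, hs⟩ := D.exists_forall_apply_eq_mem
        (f.continuous.continuousAt.preimage_mem_nhds (Metric.ball_mem_nhds (f x) (half_pos hδ)))
      have hopen : IsOpen {y : D.NInf | x.1 s = y.1 s} :=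
        (isOpen_discrete {q | x.1 s = q}).preimage (D.continuous_eval s)
      refine ⟨_, mem_nhdsWithin_of_mem_nhds (hopen.mem_nhds rfl), s, fun y hy z hyz => ?_⟩
      have h1 : dist (f y) (f x) < δ / 2 := hs y hy
      have h2 : dist (f z) (f x) < δ / 2 := hs z (Eq.trans hy hyz)
      rw [← dist_eq_norm]
      linarith [dist_triangle_right (f y) (f z) (f x)]
  obtain ⟨s, hs⟩ := key
  refine ⟨s, fun x y hxy => ?_⟩
  by_cases hx : x ∈ tsupport f
  · exact hs x hx y hxy
  by_cases hy : y ∈ tsupport f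
  · rw [norm_sub_rev]
    exact hs y hy x hxy.symm
  · rwa [image_eq_zero_of_notMem_tsupport hx, image_eq_zero_of_notMem_tsupport hy, sub_zero,
      norm_zero]

/-- The subalgebra `(θ_*)_s⁻¹(i(C*(N/M)))` of `C*(N_∞)`. -/
def level (s : D.S) : NonUnitalStarSubalgebra ℂ D.CStarNInf :=
  (NonUnitalStarAlgHom.range D.embedding).comap (D.thetaHom s)

theorem mem_level {s : D.S} {b : D.CStarNInf} :
    b ∈ D.level s ↔ ∃ a, D.embedding a = D.thetaStar s b := Iff.rfl

/-- If `(θ_*)_s(b) = i(a)`, then `(θ_*)_{rs}(b) = (θ_*)_r(i(a)) = i(α_r(a))`. -/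
theorem level_le_mul (r s : D.S) : D.level s ≤ D.level (r * s) := by
  rintro b ⟨a, ha⟩
  refine D.mem_level.2 ⟨D.heckeHom r a, ?_⟩
  rw [embedding_heckeHom, MulMemClass.coe_mul, map_mul]
  exact congrArg _ ha

theorem directed_level : Directed (· ≤ ·) D.level := fun s t => by
  obtain ⟨a, b, hab⟩ := D.exists_common s t
  exact ⟨a * s, D.level_le_mul a s, hab ▸ D.level_le_mul b t⟩

theorem of_pull_fiberChar_mem_level (s : D.S) (q : DiscQuot D.M) :
    GroupCStar.of D.haarNInf (D.pull s (D.quotNInf.fiberChar q)) ∈ D.level s := by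
  refine D.mem_level.2
    ⟨((mulEquivHaarChar (D.thetaEquiv s) : ℝ) : ℂ)⁻¹ • DiscQuot.delta q, ?_⟩
  rw [thetaStar_of, pull_pull_inv, map_smul, embedding_delta]

open scoped Pointwise in
theorem exists_mem_level_norm_sub_lt (f : C_c(D.NInf, ℂ)) {ε : ℝ} (hε : 0 < ε) :
    ∃ s : D.S, ∃ b ∈ D.level s, ‖GroupCStar.of D.haarNInf f - b‖ < ε := by
  classical
  -- `C` will contain the supports of `f` and of its approximant for every `s`, because the fibres
  -- of `x ↦ x_s` lie in cosets of `K`. A uniform error `δ` then costs at most `μ(C)δ` in `L¹`; the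
  -- `+ 1` below covers `μ(C) = 0` and makes the final bound strict.
  let C : Set D.NInf := tsupport f * (D.K : Set D.NInf)
  have hC : IsCompact C := IsCompact.mul f.hasCompactSupport D.isCompact_K
  have hδ : 0 < ε / (D.haarNInf.real C + 1) :=
    div_pos hε (add_pos_of_nonneg_of_pos measureReal_nonneg one_pos)
  set δ := ε / (D.haarNInf.real C + 1) with hδ_def
  obtain ⟨s, hs⟩ := D.exists_norm_sub_lt f hδ
  have hs' : ∀ x y, D.toQuot (D.theta s x) = D.toQuot (D.theta s y) → ‖f x - f y‖ < δ :=
    fun x y h => hs x y (D.eq_of_toQuot_theta_eq s h)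
  have hcont : Continuous fun x => D.toQuot (D.theta s x) :=
    D.continuous_toQuot.comp (D.continuous_theta s)
  have hfin : ((fun x => D.toQuot (D.theta s x)) '' C).Finite :=
    (hC.image hcont).finite_of_discrete
  have hsurj : ∀ q, ∃ x, D.toQuot (D.theta s x) = q := fun q => by
    obtain ⟨x, hx⟩ := D.quotNInf.surjective q
    exact ⟨D.theta (s : G)⁻¹ x, by rw [theta_theta_inv]; exact hx⟩
  choose r hr using hsurj
  -- The step function taking, on each of the finitely many fibres that meet `C`, the value of `f`
  -- at a chosen representative.
  let f' : C_c(D.NInf, ℂ) :=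
    ∑ q ∈ hfin.toFinset, f (r q) • D.pull s (D.quotNInf.fiberChar q)
  have hf' : ∀ x, f' x = if D.toQuot (D.theta s x) ∈ hfin.toFinset
      then f (r (D.toQuot (D.theta s x))) else 0 := fun x => by
    simp only [f', CompactlySupportedContinuousMap.sum_apply,
      CompactlySupportedContinuousMap.smul_apply, pull_apply, CompactQuotient.fiberChar_apply,
      smul_eq_mul, mul_ite, mul_one, mul_zero]
    exact Finset.sum_ite_eq _ _ _
  have hbound : ∀ x, ‖(f - f') x‖ ≤ C.indicator (fun _ => δ) x := fun x => by
    rw [CompactlySupportedContinuousMap.sub_apply, hf']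
    by_cases hx : x ∈ C
    · rw [Set.indicator_of_mem hx, if_pos (hfin.mem_toFinset.2 ⟨x, hx, rfl⟩)]
      exact (hs' _ _ (hr _).symm).le
    · have h1 : ∀ y, D.toQuot (D.theta s y) = D.toQuot (D.theta s x) → f y = 0 := fun y hy => by
        refine image_eq_zero_of_notMem_tsupport fun h => hx ⟨y, h, y⁻¹ * x, ?_,
          mul_inv_cancel_left y x⟩
        rw [SetLike.mem_coe, ← ker_toQuot, MonoidHom.mem_ker, map_mul, map_inv,
          ← D.invMap_toQuot_theta s x, ← D.invMap_toQuot_theta s y, hy, inv_mul_cancel]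
      rw [Set.indicator_of_notMem hx, h1 x rfl, h1 _ (hr _), ite_self, sub_zero, norm_zero]
  refine ⟨s, GroupCStar.of D.haarNInf f', ?_, ?_⟩
  · rw [← GroupCStar.ofₗ_apply, map_sum]
    refine sum_mem fun q _ => ?_
    rw [map_smul]
    exact SMulMemClass.smul_mem _ (D.of_pull_fiberChar_mem_level s q)
  · rw [← GroupCStar.ofₗ_apply, ← GroupCStar.ofₗ_apply, ← map_sub]
    refine (GroupCStar.norm_of_le _).trans_lt ?_
    have hmeas : MeasurableSet C := hC.measurableSet
    calc ∫ x, ‖(f - f') x‖ ∂D.haarNInf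
        ≤ ∫ x, C.indicator (fun _ => δ) x ∂D.haarNInf := by
          refine integral_mono_of_nonneg (.of_forall fun _ => norm_nonneg _) ?_
            (.of_forall hbound)
          exact (integrable_indicator_iff hmeas).2 (integrableOn_const hC.measure_lt_top.ne)
      _ = D.haarNInf.real C * δ := by
          rw [integral_indicator_const _ hmeas, smul_eq_mul]
      _ < (D.haarNInf.real C + 1) * δ := by
          gcongr
          exact lt_add_one _
      _ = ε := by
          rw [hδ_def]
          exact mul_div_cancel₀ _ (add_pos_of_nonneg_of_pos measureReal_nonneg one_pos).ne'

/-- A directed union of `*`-subalgebras is a `*`-subalgebra, so it is enough to approximate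
generators. -/
theorem dense_iUnion_level : Dense (⋃ s : D.S, (D.level s : Set D.CStarNInf)) := by
  rw [← NonUnitalStarSubalgebra.coe_iSup_of_directed D.directed_level]
  refine fun b => GroupCStar.mem_of_forall_of_mem (⨆ s, D.level s).topologicalClosure
    (NonUnitalStarSubalgebra.isClosed_topologicalClosure _) (fun f => ?_) b
  refine Metric.mem_closure_iff.2 fun ε hε => ?_
  obtain ⟨s, b, hb, h⟩ := D.exists_mem_level_norm_sub_lt f hε
  exact ⟨b, le_iSup D.level s hb, by rwa [dist_eq_norm]⟩

theorem isMinimalAutomorphicDilation :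
    IsMinimalAutomorphicDilation D.S D.heckeAction D.thetaStar D.embedding where
  injective := D.embedding_injective
  intertwines := D.embedding_heckeHom
  dense := D.dense_iUnion_level

end OreSystem

end

theorem theorem2p5 {N : Type u} {G : Type v} [Group N] [Group G] (D : OreSystem N G) :
    (∃! α : D.S →ₙ* (D.CStarQuot →⋆ₙₐ[ℂ] D.CStarQuot), D.IsHeckeAction α) ∧
    (∃! β : G →* (D.CStarNInf ≃⋆ₐ[ℂ] D.CStarNInf), D.IsThetaStar β) ∧
    (∃! i : D.CStarQuot →⋆ₙₐ[ℂ] D.CStarNInf, D.IsCanonicalEmbedding i) ∧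
    ∀ (α : D.S →ₙ* (D.CStarQuot →⋆ₙₐ[ℂ] D.CStarQuot))
      (β : G →* (D.CStarNInf ≃⋆ₐ[ℂ] D.CStarNInf))
      (i : D.CStarQuot →⋆ₙₐ[ℂ] D.CStarNInf),
      D.IsHeckeAction α → D.IsThetaStar β → D.IsCanonicalEmbedding i →
        IsMinimalAutomorphicDilation D.S α β i := by
  have h1 : ∀ α, D.IsHeckeAction α → α = D.heckeAction := fun α hα =>
    MulHom.ext hα.eq_heckeHom
  refine ⟨⟨_, D.isHeckeAction_heckeAction, h1⟩,
    ⟨_, D.isThetaStar_thetaStar, fun _ hβ => hβ.eq_thetaStar⟩,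
    ⟨_, D.isCanonicalEmbedding_embedding, fun _ hi => hi.eq_embedding⟩, fun α β i hα hβ hi => ?_⟩
  -- By uniqueness, any admissible `α`, `β`, `i` are the constructed ones.
  rw [h1 α hα, hβ.eq_thetaStar, hi.eq_embedding]
  exact D.isMinimalAutomorphicDilation
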